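/- Let $(\mathbb Y_i)_{i\ge 1}$ be measurable spaces carrying $\sigma$-finite measures $\mu_i$, let $\Theta$ be a measurable space with a prior probability measure $\Pi$, and for each $\theta\in\Theta$ and $i\ge 1$ let $f_{\theta i}$ be a probability density with respect to $\mu_i$, such that $(\theta,y)\mapsto f_{\theta i}(y)$ is jointly measurable. Let $\theta^\star\in\Theta$ and let $Y_1,Y_2,\ldots$ be independent with $Y_i\sim f_{\theta^\star i}\,d\mu_i$; write $\mathsf P$ for the underlying probability. The posterior is $$\Pi_n(B)=\frac{\int_B R_n(\theta)\,\Pi(d\theta)}{\int_\Theta R_n(\theta)\,\Pi(d\theta)},\qquad R_n(\theta)=\prod_{i=1}^n \frac{f_{\theta i}(Y_i)}{f_{\theta^\star i}(Y_i)}.$$ For densities $f,g$ with respect to $\mu$ put $K(f,g)=\int \log(f/g)\,f\,d\mu$, $V(f,g)=\int\{\log(f/g)\}^2 f\,d\mu$ and $H(f,g)=\{\int (f^{1/2}-g^{1/2})^2\,d\mu\}^{1/2}$, where $K,V\in[0,\infty]$. Let $$\bar K_n(\theta^\star,\theta)=\frac1n\sum_{i=1}^n K(f_{\theta^\star i},f_{\theta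 i}),\quad \bar V_n(\theta^\star,\theta)=\frac1n\sum_{i=1}^n V(f_{\theta^\star i},f_{\theta i}),$$ $$H_n(\theta_1,\theta_2)=\Bigl\{\frac1n\sum_{i=1}^n H(f_{\theta_1 i},f_{\theta_2 i})^2\Bigr\}^{1/2},\quad H_{n,\infty}(\theta_1,\theta_2)=\max_{1\le i\le n}H(f_{\theta_1 i},f_{\theta_2 i}).$$ For $A\subseteq\Theta$ let $N(\delta,A,H_{n,\infty})$ be the minimum number of $H_{n,\infty}$-balls of radius $\delta$ with centres in $\Theta$ needed to cover $A$. Let $(\varepsilon_n)$ be a positive sequence with $\varepsilon_n\to0$ and $n\varepsilon_n^2\to\infty$. Suppose that $\Pi$ is $\varepsilon_n$-thick at $\theta^\star$ with constant $C>0$, that is, for all sufficiently large $n$, $$\Pi\bigl(\{\theta:\bar K_n(\theta^\star,\theta)\le\varepsilon_n^2,\ \bar V_n(\theta^\star,\theta)\le\varepsilon_n^2\}\bigr)\ge e^{-Cn\varepsilon_n^2}.$$ Suppose further that there are measurable sets $\Theta_n\subseteq\Theta$ and constants $r>C+1$, $c$ and $R$ such that, for all sufficiently large $n$, $$\Pi(\Theta_n^c)\le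 c\,e^{-rn\varepsilon_n^2}\qquad\text{and}\qquad \log N(\varepsilon_n,\Theta_n,H_{n,\infty})\le R\,n\varepsilon_n^2 .$$ Then there is a constant $M_0>0$, depending only on $C$ and $R$, such that for every $M\ge M_0$ $$\Pi_n\bigl(\{\theta: H_n(\theta^\star,\theta)\ge M\varepsilon_n\}\bigr)\to0\quad\text{in }\mathsf P\text{-probability as } n\to\infty .$$ -/

import Mathlib

open MeasureTheory ProbabilityTheory Filter Topology InformationTheory
open scoped NNReal ENNReal

noncomputable section

/-- Hellinger distance `{∫ (f^{1/2} - g^{1/2})² dμ}^{1/2}` of two densities. -/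
def hellingerDist {𝓨 : Type*} [MeasurableSpace 𝓨] (μ : Measure 𝓨) (f g : 𝓨 → ℝ≥0) : ℝ :=
  Real.sqrt (∫ y, (Real.sqrt (f y) - Real.sqrt (g y)) ^ 2 ∂μ)

/-- Kullback–Leibler divergence `K(f, g) = ∫ log (f / g) f dμ ∈ [0, ∞]` of two probability
densities, i.e. the divergence of the probability measures `f dμ` and `g dμ`. -/
def klDensity {𝓨 : Type*} [MeasurableSpace 𝓨] (μ : Measure 𝓨) (f g : 𝓨 → ℝ≥0) : ℝ≥0∞ :=
  klDiv (μ.withDensity fun y => (f y : ℝ≥0∞)) (μ.withDensity fun y => (g y : ℝ≥0∞))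

/-- `V(f, g) = ∫ {log (f / g)}² f dμ ∈ [0, ∞]`. The logarithm takes values in `[-∞, ∞]`: the
integrand is `∞` where `f > 0 = g`, and it is `0` where `f = 0`. -/
def klSecondMoment {𝓨 : Type*} [MeasurableSpace 𝓨] (μ : Measure 𝓨) (f g : 𝓨 → ℝ≥0) : ℝ≥0∞ :=
  ∫⁻ y, (ENNReal.log ((f y : ℝ≥0∞) / (g y : ℝ≥0∞))).abs ^ 2 * (f y : ℝ≥0∞) ∂μ

section Model

variable {Θ : Type*} {𝓨 : ℕ → Type*} [∀ i, MeasurableSpace (𝓨 i)]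

/-- `f θ i` is, for every parameter `θ` and index `i`, a probability density with respect to
`μ i`, and depends measurably on `(θ, y)`. -/
structure IsDensityFamily [MeasurableSpace Θ] (μ : ∀ i, Measure (𝓨 i)) (f : Θ → ∀ i, 𝓨 i → ℝ≥0) : Prop where
  measurable : ∀ i, Measurable fun p : Θ × 𝓨 i => f p.1 i p.2
  lintegral_eq_one : ∀ θ i, ∫⁻ y, (f θ i y : ℝ≥0∞) ∂(μ i) = 1

/-- The averaged Kullback–Leibler divergence of the first `n` observations
(observations are numbered from `0`). -/
def meanKL (μ : ∀ i, Measure (𝓨 i)) (f : Θ → ∀ i, 𝓨 i → ℝ≥0) (n : ℕ) (θ₀ θ : Θ) : ℝ≥0∞ :=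
  (∑ i ∈ Finset.range n, klDensity (μ i) (f θ₀ i) (f θ i)) / n

/-- The averaged `V` of the first `n` observations. -/
def meanKLSecondMoment (μ : ∀ i, Measure (𝓨 i)) (f : Θ → ∀ i, 𝓨 i → ℝ≥0) (n : ℕ)
    (θ₀ θ : Θ) : ℝ≥0∞ :=
  (∑ i ∈ Finset.range n, klSecondMoment (μ i) (f θ₀ i) (f θ i)) / n

/-- The mean-Hellinger distance `H_n`. -/
def meanHellinger (μ : ∀ i, Measure (𝓨 i)) (f : Θ → ∀ i, 𝓨 i → ℝ≥0) (n : ℕ)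
    (θ₁ θ₂ : Θ) : ℝ :=
  Real.sqrt ((1 / (n : ℝ)) * ∑ i ∈ Finset.range n, hellingerDist (μ i) (f θ₁ i) (f θ₂ i) ^ 2)

/-- The max-Hellinger distance `H_{n,∞}`. -/
def maxHellinger (μ : ∀ i, Measure (𝓨 i)) (f : Θ → ∀ i, 𝓨 i → ℝ≥0) (n : ℕ)
    (θ₁ θ₂ : Θ) : ℝ :=
  ⨆ i : Fin n, hellingerDist (μ i) (f θ₁ i) (f θ₂ i)

/-- Covering number: the least number of `d`-balls of radius `δ`, with arbitrary centres in the
space, needed to cover `A` (it is `⊤` if no finite number suffices). -/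
def ballCoveringNumber {X : Type*} (d : X → X → ℝ) (δ : ℝ) (A : Set X) : ℕ∞ :=
  ⨅ (S : Set X) (_ : A ⊆ ⋃ c ∈ S, {x | d c x ≤ δ}), S.encard

/-- The prior is `ε_n`-thick at `θ₀` with constant `C`. -/
structure IsThick [MeasurableSpace Θ] (μ : ∀ i, Measure (𝓨 i)) (f : Θ → ∀ i, 𝓨 i → ℝ≥0) (prior : Measure Θ)
    (θ₀ : Θ) (ε : ℕ → ℝ) (C : ℝ) : Prop where
  rate_pos : ∀ n, 0 < ε n
  rate_tendsto : Tendsto ε atTop (𝓝 0)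
  rate_sq_tendsto : Tendsto (fun n : ℕ => (n : ℝ) * ε n ^ 2) atTop atTop
  const_pos : 0 < C
  thick : ∀ᶠ n : ℕ in atTop, ENNReal.ofReal (Real.exp (-(C * (n * ε n ^ 2)))) ≤
    prior {θ | meanKL μ f n θ₀ θ ≤ ENNReal.ofReal (ε n ^ 2) ∧
      meanKLSecondMoment μ f n θ₀ θ ≤ ENNReal.ofReal (ε n ^ 2)}

/-- The likelihood ratio `R_n(θ) = ∏ f_{θ i}(Y_i) / f_{θ₀ i}(Y_i)` at the data `y`. -/
def likelihoodRatio (f : Θ → ∀ i, 𝓨 i → ℝ≥0) (θ₀ : Θ) (n : ℕ) (y : ∀ i, 𝓨 i) (θ : Θ) : ℝ≥0 :=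
  ∏ i ∈ Finset.range n, f θ i (y i) / f θ₀ i (y i)

/-- The posterior probability of `B` given the first `n` coordinates of the data `y`; the ratio
of extended nonnegative numbers under `toReal` is at most `1`, so never infinite. -/
def posteriorProb [MeasurableSpace Θ] (f : Θ → ∀ i, 𝓨 i → ℝ≥0) (prior : Measure Θ) (θ₀ : Θ)
    (n : ℕ) (y : ∀ i, 𝓨 i) (B : Set Θ) : ℝ :=
  ((∫⁻ θ in B, (likelihoodRatio f θ₀ n y θ : ℝ≥0∞) ∂prior) /
    ∫⁻ θ, (likelihoodRatio f θ₀ n y θ : ℝ≥0∞) ∂prior).toReal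

end Model

end

/-!
The posterior mass of the parameters far from `θ₀` is a ratio of the integrals of the likelihood
ratio `R_n` over these parameters and over all parameters; write `T = n ε²`. No tests are
constructed: numerators are controlled through their square roots, as in Walker's approach to
posterior consistency.

*Numerator on a ball.* If a mixing measure lives on a max-Hellinger ball of radius `ε` around `c`,
then the predictive density of each observation given the previous ones is a mixture of densities
in a Hellinger ball around `f c i`. The affinity is concave, so such a mixture stays in that ball,
and its affinity to `f θ₀ i` is at most `exp (-H(f θ₀ i, f c i)² / 4 + ε² / 2)`
(`hellingerAffinity_mixture_le`). Multiplying over the observations, the square root of the integral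
of `R_n` over the ball has mean at most `exp (-n H_n(θ₀, c)² / 4 + T / 2)`
(`lintegral_sqrt_likelihoodRatio_le`). This is where the entropy has to be measured in the
max-Hellinger distance, whereas the separation is in mean-Hellinger distance.

*Denominator.* By Chebyshev's inequality, each parameter of the Kullback–Leibler neighbourhood in the
thickness condition has `R_n ≥ exp (-(1 + d) T)` with probability at least `1 - 1 / (d² T)`. By
Fubini and Markov this holds with high probability on at least half of that neighbourhood, so that
the denominator is at least a constant times `exp (-(1 + d + C) T)` (`measure_evidence_lt_le`).

*Conclusion.* The complement of the sieve contributes at most its prior mass on average, divided by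
the bound for the denominator; this vanishes since `r > C + 1`. The far part of the sieve is covered
by at most `exp (R T)` balls with centres at mean-Hellinger distance of order `M ε`. The posterior
probability of each is at most one, hence at most its own square root, and the sum of the means of
these roots vanishes once `M` is large in terms of `C` and `R` (`measure_le_posteriorProb_le_exp`).
-/

/-! ### Hellinger affinity and mixtures of densities -/

section Affinity

variable {𝓨 : Type*} [MeasurableSpace 𝓨] {μ : Measure 𝓨}

/-- Hellinger affinity `∫ √p √q dμ` of two extended nonnegative functions. -/
noncomputable def hellingerAffinity (μ : Measure 𝓨) (p q : 𝓨 → ℝ≥0∞) : ℝ≥0∞ :=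
  ∫⁻ y, p y ^ (1 / 2 : ℝ) * q y ^ (1 / 2 : ℝ) ∂μ

lemma hellingerDist_nonneg (f g : 𝓨 → ℝ≥0) : 0 ≤ hellingerDist μ f g := Real.sqrt_nonneg _

lemma hellingerDist_comm (f g : 𝓨 → ℝ≥0) : hellingerDist μ f g = hellingerDist μ g f := by
  unfold hellingerDist
  congr 2 with y
  ring

lemma integrable_coe_of_lintegral_eq_one {f : 𝓨 → ℝ≥0} (hf : Measurable f)
    (h1 : ∫⁻ y, (f y : ℝ≥0∞) ∂μ = 1) : Integrable (fun y => (f y : ℝ)) μ := by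
  refine ⟨hf.coe_nnreal_real.aestronglyMeasurable, ?_⟩
  simp [HasFiniteIntegral, enorm_eq_nnnorm, h1]

lemma integral_coe_of_lintegral_eq_one {f : 𝓨 → ℝ≥0} (hf : Measurable f)
    (h1 : ∫⁻ y, (f y : ℝ≥0∞) ∂μ = 1) : ∫ y, (f y : ℝ) ∂μ = 1 := by
  rw [integral_eq_lintegral_of_nonneg_ae (ae_of_all _ fun y => (f y).coe_nonneg)
    hf.coe_nnreal_real.aestronglyMeasurable]
  simp [h1]

lemma integrable_sqrt_mul_sqrt {f g : 𝓨 → ℝ≥0} (hf : Measurable f) (hg : Measurable g)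
    (hf1 : ∫⁻ y, (f y : ℝ≥0∞) ∂μ = 1) (hg1 : ∫⁻ y, (g y : ℝ≥0∞) ∂μ = 1) :
    Integrable (fun y => √(f y : ℝ) * √(g y : ℝ)) μ := by
  refine ((integrable_coe_of_lintegral_eq_one hf hf1).add
    (integrable_coe_of_lintegral_eq_one hg hg1)).mono' (by fun_prop) (ae_of_all _ fun y => ?_)
  rw [Real.norm_of_nonneg (by positivity)]
  have h1 := Real.sq_sqrt (f y).coe_nonneg
  have h2 := Real.sq_sqrt (g y).coe_nonneg
  simp only [Pi.add_apply]
  nlinarith [sq_nonneg (√(f y : ℝ) - √(g y : ℝ)), Real.sqrt_nonneg (f y : ℝ),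
    Real.sqrt_nonneg (g y : ℝ)]

lemma hellingerDist_sq_eq {f g : 𝓨 → ℝ≥0} (hf : Measurable f) (hg : Measurable g)
    (hf1 : ∫⁻ y, (f y : ℝ≥0∞) ∂μ = 1) (hg1 : ∫⁻ y, (g y : ℝ≥0∞) ∂μ = 1) :
    hellingerDist μ f g ^ 2 = 2 - 2 * ∫ y, √(f y : ℝ) * √(g y : ℝ) ∂μ := by
  rw [hellingerDist, Real.sq_sqrt (integral_nonneg fun y => sq_nonneg _)]
  have : ∀ y, (√(f y : ℝ) - √(g y : ℝ)) ^ 2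
      = ((f y : ℝ) + g y) - 2 * (√(f y : ℝ) * √(g y : ℝ)) := fun y => by
    rw [sub_sq, Real.sq_sqrt (f y).coe_nonneg, Real.sq_sqrt (g y).coe_nonneg]; ring
  simp_rw [this]
  rw [integral_sub (f := fun y => (f y : ℝ) + g y) ((integrable_coe_of_lintegral_eq_one hf
    hf1).add (integrable_coe_of_lintegral_eq_one hg hg1))
    ((integrable_sqrt_mul_sqrt hf hg hf1 hg1).const_mul 2),
    integral_add (integrable_coe_of_lintegral_eq_one hf hf1)
    (integrable_coe_of_lintegral_eq_one hg hg1), integral_const_mul,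
    integral_coe_of_lintegral_eq_one hf hf1, integral_coe_of_lintegral_eq_one hg hg1]
  ring

lemma coe_rpow_half (x : ℝ≥0) : (x : ℝ≥0∞) ^ (1 / 2 : ℝ) = ENNReal.ofReal √(x : ℝ) := by
  rw [Real.sqrt_eq_rpow, ← ENNReal.ofReal_rpow_of_nonneg x.coe_nonneg (by norm_num),
    ENNReal.ofReal_coe_nnreal]

lemma hellingerAffinity_coe {f g : 𝓨 → ℝ≥0} (hf : Measurable f) (hg : Measurable g)
    (hf1 : ∫⁻ y, (f y : ℝ≥0∞) ∂μ = 1) (hg1 : ∫⁻ y, (g y : ℝ≥0∞) ∂μ = 1) :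
    hellingerAffinity μ (fun y => f y) (fun y => g y)
      = ENNReal.ofReal (1 - hellingerDist μ f g ^ 2 / 2) := by
  rw [hellingerDist_sq_eq hf hg hf1 hg1, hellingerAffinity]
  have : ∀ y, (f y : ℝ≥0∞) ^ (1 / 2 : ℝ) * (g y : ℝ≥0∞) ^ (1 / 2 : ℝ)
      = ENNReal.ofReal (√(f y : ℝ) * √(g y : ℝ)) := fun y => by
    rw [coe_rpow_half, coe_rpow_half, ENNReal.ofReal_mul (Real.sqrt_nonneg _)]
  simp_rw [this]
  rw [← ofReal_integral_eq_lintegral_ofReal (integrable_sqrt_mul_sqrt hf hg hf1 hg1)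
    (ae_of_all _ fun y => by positivity)]
  congr 1
  ring

lemma hellingerDist_sq_le_two {f g : 𝓨 → ℝ≥0} (hf : Measurable f) (hg : Measurable g)
    (hf1 : ∫⁻ y, (f y : ℝ≥0∞) ∂μ = 1) (hg1 : ∫⁻ y, (g y : ℝ≥0∞) ∂μ = 1) :
    hellingerDist μ f g ^ 2 ≤ 2 := by
  rw [hellingerDist_sq_eq hf hg hf1 hg1]
  have : 0 ≤ ∫ y, √(f y : ℝ) * √(g y : ℝ) ∂μ := integral_nonneg fun y => by positivity
  linarith

lemma rpow_half_mul_self (x : ℝ≥0∞) : x ^ (1 / 2 : ℝ) * x ^ (1 / 2 : ℝ) = x := by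
  rw [← ENNReal.rpow_add_of_nonneg _ _ (by norm_num) (by norm_num)]
  norm_num

/-- The pointwise form of `(a - b)² ≤ 2 (a - s)² + 2 (s - b)²`, without subtraction. -/
lemma four_mul_add_le (a s b : ℝ≥0∞) :
    4 * (a * s) + 4 * (s * b) ≤ a * a + b * b + 4 * (s * s) + 2 * (a * b) := by
  induction a with
  | top => simp
  | coe a =>
  induction b with
  | top => simp
  | coe b =>
  induction s with
  | top => simp
  | coe s =>
    norm_cast
    rw [← NNReal.coe_le_coe]
    push_cast
    nlinarith [sq_nonneg ((a : ℝ) + b - 2 * s)]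

/-- The relaxed triangle inequality `H(p, g)² ≤ 2 H(p, q)² + 2 H(q, g)²` in terms of affinities. -/
lemma hellingerAffinity_add_le {p q g : 𝓨 → ℝ≥0∞} (hp : Measurable p) (hq : Measurable q)
    (hg : Measurable g) (hp1 : ∫⁻ y, p y ∂μ = 1) (hq1 : ∫⁻ y, q y ∂μ = 1)
    (hg1 : ∫⁻ y, g y ∂μ = 1) :
    4 * hellingerAffinity μ p q + 4 * hellingerAffinity μ q g
      ≤ 6 + 2 * hellingerAffinity μ p g := by
  have h := lintegral_mono (μ := μ) fun y =>
    four_mul_add_le (p y ^ (1 / 2 : ℝ)) (q y ^ (1 / 2 : ℝ)) (g y ^ (1 / 2 : ℝ))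
  simp only [rpow_half_mul_self] at h
  rw [lintegral_add_left (by fun_prop), lintegral_const_mul _ (by fun_prop),
    lintegral_const_mul _ (by fun_prop), lintegral_add_left (by fun_prop),
    lintegral_add_left (by fun_prop), lintegral_add_left (by fun_prop),
    lintegral_const_mul _ (by fun_prop), lintegral_const_mul _ (by fun_prop), hp1, hq1, hg1] at h
  refine h.trans (le_of_eq ?_)
  rw [hellingerAffinity]
  norm_num

lemma hellingerDist_sq_le_add {p q g : 𝓨 → ℝ≥0}
    (hp : Measurable p) (hq : Measurable q) (hg : Measurable g)
    (hp1 : ∫⁻ y, (p y : ℝ≥0∞) ∂μ = 1) (hq1 : ∫⁻ y, (q y : ℝ≥0∞) ∂μ = 1)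
    (hg1 : ∫⁻ y, (g y : ℝ≥0∞) ∂μ = 1) :
    hellingerDist μ p g ^ 2 ≤ 2 * hellingerDist μ p q ^ 2 + 2 * hellingerDist μ q g ^ 2 := by
  have key := hellingerAffinity_add_le (μ := μ) hp.coe_nnreal_ennreal hq.coe_nnreal_ennreal
    hg.coe_nnreal_ennreal hp1 hq1 hg1
  rw [hellingerAffinity_coe hp hq hp1 hq1, hellingerAffinity_coe hq hg hq1 hg1,
    hellingerAffinity_coe hp hg hp1 hg1] at key
  have h1 := hellingerDist_sq_le_two hp hq hp1 hq1
  have h2 := hellingerDist_sq_le_two hq hg hq1 hg1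
  have h3 := hellingerDist_sq_le_two hp hg hp1 hg1
  have hreal := ENNReal.toReal_mono (by finiteness) key
  rw [ENNReal.toReal_add (by finiteness) (by finiteness),
    ENNReal.toReal_add (by finiteness) (by finiteness)] at hreal
  simp only [ENNReal.toReal_mul, ENNReal.toReal_ofNat] at hreal
  rw [ENNReal.toReal_ofReal (by linarith), ENNReal.toReal_ofReal (by linarith),
    ENNReal.toReal_ofReal (by linarith)] at hreal
  linarith

/-- Jensen's inequality for the square root. -/
lemma lintegral_rpow_half_le {Θ : Type*} [MeasurableSpace Θ] (ν : Measure Θ)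
    [IsProbabilityMeasure ν] {h : Θ → ℝ≥0∞} (hh : Measurable h) :
    ∫⁻ θ, h θ ^ (1 / 2 : ℝ) ∂ν ≤ (∫⁻ θ, h θ ∂ν) ^ (1 / 2 : ℝ) := by
  have := ENNReal.lintegral_mul_le_Lp_mul_Lq ν Real.HolderConjugate.two_two
    (f := fun θ => h θ ^ (1 / 2 : ℝ)) (g := fun _ => 1) (by fun_prop) (by fun_prop)
  simpa [← ENNReal.rpow_ofNat, ← ENNReal.rpow_mul] using this

/-- The affinity to a fixed density is concave: a mixture of densities is at least as close to `g`
as its components are on average. -/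
lemma lintegral_hellingerAffinity_le {Θ : Type*} [MeasurableSpace Θ] (ν : Measure Θ)
    [IsProbabilityMeasure ν] [SFinite μ] {h : Θ → 𝓨 → ℝ≥0}
    (hh : Measurable fun x : Θ × 𝓨 => h x.1 x.2) {g : 𝓨 → ℝ≥0} (hg : Measurable g) :
    ∫⁻ θ, hellingerAffinity μ (fun y => h θ y) (fun y => g y) ∂ν
      ≤ hellingerAffinity μ (fun y => ∫⁻ θ, h θ y ∂ν) (fun y => g y) := by
  unfold hellingerAffinity
  have hm : Measurable fun x : Θ × 𝓨 =>
      (h x.1 x.2 : ℝ≥0∞) ^ (1 / 2 : ℝ) * (g x.2 : ℝ≥0∞) ^ (1 / 2 : ℝ) := by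
    fun_prop
  rw [lintegral_lintegral_swap hm.aemeasurable]
  refine lintegral_mono fun y => ?_
  have h1 : Measurable fun θ => (h θ y : ℝ≥0∞) :=
    (hh.comp (measurable_id.prodMk measurable_const)).coe_nnreal_ennreal
  rw [lintegral_mul_const _ (by fun_prop)]
  gcongr
  exact lintegral_rpow_half_le ν h1

/-- The Hellinger ball of radius `δ` around `g` contains all mixtures of its elements; hence a
mixture is separated from `p` as soon as `g` is. -/
lemma hellingerAffinity_mixture_le {Θ : Type*} [MeasurableSpace Θ] (ν : Measure Θ)
    [IsProbabilityMeasure ν] [SFinite μ] {h : Θ → 𝓨 → ℝ≥0}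
    (hh : Measurable fun x : Θ × 𝓨 => h x.1 x.2) (hh1 : ∀ θ, ∫⁻ y, (h θ y : ℝ≥0∞) ∂μ = 1)
    {p g : 𝓨 → ℝ≥0} (hp : Measurable p) (hg : Measurable g)
    (hp1 : ∫⁻ y, (p y : ℝ≥0∞) ∂μ = 1) (hg1 : ∫⁻ y, (g y : ℝ≥0∞) ∂μ = 1) {δ : ℝ}
    (hδ : ∀ᵐ θ ∂ν, hellingerDist μ g (h θ) ≤ δ) :
    hellingerAffinity μ (fun y => p y) (fun y => ∫⁻ θ, h θ y ∂ν)
      ≤ ENNReal.ofReal (Real.exp (-(hellingerDist μ p g ^ 2 / 4) + δ ^ 2 / 2)) := by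
  have hm : Measurable fun x : Θ × 𝓨 => (h x.1 x.2 : ℝ≥0∞) := by fun_prop
  have hq : Measurable fun y => ∫⁻ θ, (h θ y : ℝ≥0∞) ∂ν := hm.lintegral_prod_left'
  have hq1 : ∫⁻ y, ∫⁻ θ, (h θ y : ℝ≥0∞) ∂ν ∂μ = 1 := by
    rw [← lintegral_lintegral_swap hm.aemeasurable]; simp [hh1]
  have key := hellingerAffinity_add_le (μ := μ) hp.coe_nnreal_ennreal hq hg.coe_nnreal_ennreal
    hp1 hq1 hg1
  have hβ : ENNReal.ofReal (1 - δ ^ 2 / 2)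
      ≤ hellingerAffinity μ (fun y => ∫⁻ θ, h θ y ∂ν) (fun y => g y) := by
    refine le_trans ?_ (lintegral_hellingerAffinity_le ν hh hg)
    calc ENNReal.ofReal (1 - δ ^ 2 / 2) = ∫⁻ _, ENNReal.ofReal (1 - δ ^ 2 / 2) ∂ν := by simp
      _ ≤ _ := by
        refine lintegral_mono_ae (hδ.mono fun θ hθ => ?_)
        rw [hellingerAffinity_coe (f := h θ) (hh.comp measurable_prodMk_left) hg (hh1 θ) hg1,
          hellingerDist_comm]
        have := hellingerDist_nonneg (μ := μ) g (h θ)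
        gcongr
  rw [hellingerAffinity_coe hp hg hp1 hg1] at key
  set α := hellingerAffinity μ (fun y => p y) (fun y => ∫⁻ θ, h θ y ∂ν)
  have hfin : α ≠ ∞ := by
    rintro h'
    rw [h'] at key
    refine absurd key (not_le.2 ?_)
    simp only [ENNReal.mul_top, ne_eq, OfNat.ofNat_ne_zero, not_false_eq_true, top_add]
    finiteness
  have hH := hellingerDist_sq_le_two hp hg hp1 hg1 (μ := μ)
  have key2 : 4 * α + 4 * ENNReal.ofReal (1 - δ ^ 2 / 2)
      ≤ 6 + 2 * ENNReal.ofReal (1 - hellingerDist μ p g ^ 2 / 2) :=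
    le_trans (by gcongr) key
  rw [← ENNReal.ofReal_toReal hfin]
  have hreal := ENNReal.toReal_mono (by finiteness) key2
  rw [ENNReal.toReal_add (by finiteness) (by finiteness),
    ENNReal.toReal_add (by finiteness) (by finiteness)] at hreal
  simp only [ENNReal.toReal_mul, ENNReal.toReal_ofNat] at hreal
  rw [ENNReal.toReal_ofReal (by linarith : 0 ≤ 1 - hellingerDist μ p g ^ 2 / 2)] at hreal
  have h3 : 1 - δ ^ 2 / 2 ≤ (ENNReal.ofReal (1 - δ ^ 2 / 2)).toReal := by
    rw [ENNReal.toReal_ofReal']; exact le_max_left _ _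
  gcongr
  refine le_trans ?_ (Real.add_one_le_exp _)
  linarith

end Affinity

/-! ### Integrated likelihood ratios of independent observations -/

/-- The case of a single observation from `p`: the mean of the root of the likelihood ratio, mixed
over a measure `ν` living on a Hellinger ball around `g`, not necessarily of total mass one. -/
lemma lintegral_sqrt_mixture_le {𝓨 Θ : Type*} [MeasurableSpace 𝓨] [MeasurableSpace Θ]
    {μ : Measure 𝓨} [SFinite μ] (ν : Measure Θ) {h : Θ → 𝓨 → ℝ≥0}
    (hh : Measurable fun x : Θ × 𝓨 => h x.1 x.2) (hh1 : ∀ θ, ∫⁻ y, (h θ y : ℝ≥0∞) ∂μ = 1)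
    {p g : 𝓨 → ℝ≥0} (hp : Measurable p) (hg : Measurable g)
    (hp1 : ∫⁻ y, (p y : ℝ≥0∞) ∂μ = 1) (hg1 : ∫⁻ y, (g y : ℝ≥0∞) ∂μ = 1) {δ : ℝ}
    (hδ : ∀ᵐ θ ∂ν, hellingerDist μ g (h θ) ≤ δ) :
    ∫⁻ y, (∫⁻ θ, ((h θ y / p y : ℝ≥0) : ℝ≥0∞) ∂ν) ^ (1 / 2 : ℝ)
        ∂(μ.withDensity fun y => (p y : ℝ≥0∞))
      ≤ ν Set.univ ^ (1 / 2 : ℝ)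
        * ENNReal.ofReal (Real.exp (-(hellingerDist μ p g ^ 2 / 4) + δ ^ 2 / 2)) := by
  have hexp : ENNReal.ofReal (Real.exp (-(hellingerDist μ p g ^ 2 / 4) + δ ^ 2 / 2)) ≠ 0 :=
    (ENNReal.ofReal_pos.2 (Real.exp_pos _)).ne'
  rcases eq_or_ne (ν Set.univ) ∞ with hT | hT
  · rw [hT, ENNReal.top_rpow_of_pos (by norm_num), ENNReal.top_mul hexp]
    exact le_top
  rcases eq_or_ne (ν Set.univ) 0 with h0 | h0
  · rw [Measure.measure_univ_eq_zero] at h0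
    simp [h0]
  set T := ν Set.univ
  have : IsProbabilityMeasure (T⁻¹ • ν) :=
    ⟨by simpa [T] using ENNReal.inv_mul_cancel h0 hT⟩
  have hν : ν = T • (T⁻¹ • ν) := by
    rw [smul_smul, ENNReal.mul_inv_cancel h0 hT, one_smul]
  have key := hellingerAffinity_mixture_le (T⁻¹ • ν) hh hh1 hp hg hp1 hg1 (δ := δ)
    (Measure.ae_smul_measure hδ _)
  refine le_trans ?_ (mul_le_mul_right key (T ^ (1 / 2 : ℝ)))
  set ν' := T⁻¹ • ν
  have hm : Measurable fun x : Θ × 𝓨 => (h x.1 x.2 : ℝ≥0∞) := by fun_prop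
  have hq : Measurable fun y => ∫⁻ θ, (h θ y : ℝ≥0∞) ∂ν' := hm.lintegral_prod_left'
  have hm2 : Measurable fun x : Θ × 𝓨 => ((h x.1 x.2 / p x.2 : ℝ≥0) : ℝ≥0∞) := by fun_prop
  have : IsFiniteMeasure ν := ⟨hT.lt_top⟩
  rw [lintegral_withDensity_eq_lintegral_mul _ (by fun_prop)
    (by exact (hm2.lintegral_prod_left' (μ := ν)).pow_const _), hellingerAffinity,
    ← lintegral_const_mul _ (by fun_prop)]
  refine lintegral_mono fun y => ?_
  simp only [Pi.mul_apply]
  rcases eq_or_ne (p y) 0 with hpy | hpy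
  · simp [hpy]
  have h1 : Measurable fun θ => (h θ y : ℝ≥0∞) :=
    (hh.comp (measurable_id.prodMk measurable_const)).coe_nnreal_ennreal
  have hpy' : (p y : ℝ≥0∞) ≠ 0 := by simpa using hpy
  have h2 : ∫⁻ θ, ((h θ y / p y : ℝ≥0) : ℝ≥0∞) ∂ν
      = T * (∫⁻ θ, (h θ y : ℝ≥0∞) ∂ν') / p y := by
    simp_rw [ENNReal.coe_div hpy, div_eq_mul_inv]
    rw [lintegral_mul_const _ h1]
    conv_lhs => rw [hν, lintegral_smul_measure, smul_eq_mul]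
  rw [h2, ENNReal.div_rpow_of_nonneg _ _ (by norm_num), ENNReal.mul_rpow_of_nonneg _ _ (by norm_num)]
  have h4 : (p y : ℝ≥0∞) ^ (1 / 2 : ℝ) ≠ 0 := by simp [hpy]
  have h5 : (p y : ℝ≥0∞) ^ (1 / 2 : ℝ) ≠ ∞ := by finiteness
  suffices h : (p y : ℝ≥0∞) ^ (1 / 2 : ℝ) * (p y : ℝ≥0∞) ^ (1 / 2 : ℝ)
      * (T ^ (1 / 2 : ℝ) * (∫⁻ θ, (h θ y : ℝ≥0∞) ∂ν') ^ (1 / 2 : ℝ) / (p y : ℝ≥0∞) ^ (1 / 2 : ℝ))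
      ≤ T ^ (1 / 2 : ℝ) * ((p y : ℝ≥0∞) ^ (1 / 2 : ℝ)
        * (∫⁻ θ, (h θ y : ℝ≥0∞) ∂ν') ^ (1 / 2 : ℝ)) by
    rwa [rpow_half_mul_self] at h
  set a := (p y : ℝ≥0∞) ^ (1 / 2 : ℝ)
  set b := T ^ (1 / 2 : ℝ)
  set m := (∫⁻ θ, (h θ y : ℝ≥0∞) ∂ν') ^ (1 / 2 : ℝ)
  refine le_of_eq ?_
  calc a * a * (b * m / a) = a * (a * (a⁻¹ * (b * m))) := by rw [div_eq_mul_inv]; ring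
    _ = a * (b * m) := by rw [← mul_assoc a a⁻¹, ENNReal.mul_inv_cancel h4 h5, one_mul]
    _ = b * (a * m) := by ring

section Model

variable {Ω : Type*} [MeasurableSpace Ω] {P : Measure Ω}
  {𝓨 : ℕ → Type*} [∀ i, MeasurableSpace (𝓨 i)] {μ : ∀ i, Measure (𝓨 i)}
  {Θ : Type*} [MeasurableSpace Θ] {f : Θ → ∀ i, 𝓨 i → ℝ≥0} {θ₀ : Θ} {Y : ∀ i, Ω → 𝓨 i}

/-- Integrating out the last of `n + 1` independent observations. -/
lemma lintegral_prefix_of_iIndepFun (hY : ∀ i, Measurable (Y i)) (hindep : iIndepFun Y P) (n : ℕ)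
    {F : (∀ i : Finset.range n, 𝓨 i) → 𝓨 n → ℝ≥0∞}
    (hF : Measurable fun x : (∀ i : Finset.range n, 𝓨 i) × 𝓨 n => F x.1 x.2) :
    ∫⁻ ω, F (fun i => Y i ω) (Y n ω) ∂P
      = ∫⁻ ω, ∫⁻ y, F (fun i => Y i ω) y ∂(P.map (Y n)) ∂P := by
  have := hindep.isProbabilityMeasure
  have h1 := hindep.indepFun_finset (Finset.range n) {n} (by simp) hY
  have h2 : IndepFun (fun ω (i : Finset.range n) => Y i ω) (Y n) P :=
    h1.comp (φ := id)
      (ψ := fun z : ∀ i : ({n} : Finset ℕ), 𝓨 i => z ⟨n, Finset.mem_singleton_self n⟩)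
      measurable_id (measurable_pi_apply _)
  have hm : Measurable fun ω (i : Finset.range n) => Y i ω := by fun_prop
  have h3 := h2.map_prod_eq_prod_map_map hm.aemeasurable (hY n).aemeasurable
  calc ∫⁻ ω, F (fun i => Y i ω) (Y n ω) ∂P
      = ∫⁻ x, F x.1 x.2 ∂(P.map fun ω => ((fun (i : Finset.range n) => Y i ω), Y n ω)) := by
        rw [lintegral_map hF (hm.prodMk (hY n))]
    _ = ∫⁻ z, ∫⁻ y, F z y ∂(P.map (Y n)) ∂(P.map fun ω (i : Finset.range n) => Y i ω) := by
        have := Measure.isProbabilityMeasure_map (hY n).aemeasurable (μ := P)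
        rw [h3, lintegral_prod _ hF.aemeasurable]
    _ = _ := by
        have := Measure.isProbabilityMeasure_map (hY n).aemeasurable (μ := P)
        rw [lintegral_map hF.lintegral_prod_right' hm]

lemma IsDensityFamily.measurable_apply (hf : IsDensityFamily μ f) (θ : Θ) (i : ℕ) :
    Measurable (f θ i) :=
  (hf.measurable i).comp measurable_prodMk_left

lemma IsDensityFamily.measurable_comp (hf : IsDensityFamily μ f) {α : Type*} [MeasurableSpace α]
    (i : ℕ) {u : α → Θ} {v : α → 𝓨 i} (hu : Measurable u) (hv : Measurable v) :
    Measurable fun a => f (u a) i (v a) :=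
  (hf.measurable i).comp (hu.prodMk hv)

lemma IsDensityFamily.measurable_likelihoodRatio (hf : IsDensityFamily μ f)
    (hY : ∀ i, Measurable (Y i)) (n : ℕ) :
    Measurable fun x : Ω × Θ => likelihoodRatio f θ₀ n (fun i => Y i x.1) x.2 := by
  unfold likelihoodRatio
  refine Finset.measurable_prod _ fun i _ => ?_
  exact (hf.measurable_comp i measurable_snd ((hY i).comp measurable_fst)).div
    ((hf.measurable_apply θ₀ i).comp ((hY i).comp measurable_fst))

/-- If the finite measure `ν` lives on a max-Hellinger ball around `c`, then the root of the
likelihood ratio mixed over `ν` has exponentially small mean as soon as `c` is far from `θ₀` in mean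
Hellinger distance. Conditionally on the past, the next observation is confronted with the predictive
density, a mixture of densities in the Hellinger ball around `f c n`. -/
lemma lintegral_sqrt_likelihoodRatio_le [∀ i, SigmaFinite (μ i)] (hf : IsDensityFamily μ f) (hY : ∀ i, Measurable (Y i))
    (hindep : iIndepFun Y P)
    (hlaw : ∀ i, P.map (Y i) = (μ i).withDensity fun y => (f θ₀ i y : ℝ≥0∞))
    (ν : Measure Θ) [IsFiniteMeasure ν] (c : Θ) (δ : ℝ) (n : ℕ)
    (hδ : ∀ i < n, ∀ᵐ θ ∂ν, hellingerDist (μ i) (f c i) (f θ i) ≤ δ) :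
    ∫⁻ ω, (∫⁻ θ, (likelihoodRatio f θ₀ n (fun i => Y i ω) θ : ℝ≥0∞) ∂ν) ^ (1 / 2 : ℝ) ∂P
      ≤ ν Set.univ ^ (1 / 2 : ℝ) * ENNReal.ofReal (Real.exp (∑ i ∈ Finset.range n,
          (-(hellingerDist (μ i) (f θ₀ i) (f c i) ^ 2 / 4) + δ ^ 2 / 2))) := by
  induction n with
  | zero =>
    have := hindep.isProbabilityMeasure
    simp [likelihoodRatio]
  | succ n ih =>
    specialize ih fun i hi => hδ i (by omega)
    let L : (∀ i : Finset.range n, 𝓨 i) → Θ → ℝ≥0 := fun z θ =>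
      ∏ i : Finset.range n, f θ i (z i) / f θ₀ i (z i)
    have hL : ∀ ω θ, likelihoodRatio f θ₀ n (fun i => Y i ω) θ
        = L (fun i => Y i ω) θ := fun ω θ =>
      (Finset.prod_coe_sort (Finset.range n) fun i => f θ i (Y i ω) / f θ₀ i (Y i ω)).symm
    have hLm : Measurable fun x : (∀ i : Finset.range n, 𝓨 i) × Θ => L x.1 x.2 := by
      refine Finset.measurable_prod _ fun i _ => ?_
      exact (hf.measurable_comp i measurable_snd (by fun_prop)).div
        ((hf.measurable_apply θ₀ i).comp (by fun_prop))
    let F : (∀ i : Finset.range n, 𝓨 i) → 𝓨 n → ℝ≥0∞ := fun z y =>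
      (∫⁻ θ, (L z θ : ℝ≥0∞) * ((f θ n y / f θ₀ n y : ℝ≥0) : ℝ≥0∞) ∂ν) ^ (1 / 2 : ℝ)
    have hF : Measurable fun x : (∀ i : Finset.range n, 𝓨 i) × 𝓨 n => F x.1 x.2 := by
      refine Measurable.pow_const (Measurable.lintegral_prod_right' (f := fun x :
        ((∀ i : Finset.range n, 𝓨 i) × 𝓨 n) × Θ => (L x.1.1 x.2 : ℝ≥0∞)
          * ((f x.2 n x.1.2 / f θ₀ n x.1.2 : ℝ≥0) : ℝ≥0∞)) ?_) _
      refine Measurable.fun_mul ?_ ?_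
      · exact (hLm.comp ((measurable_fst.comp measurable_fst).prodMk
          measurable_snd)).coe_nnreal_ennreal
      · exact ((hf.measurable_comp n measurable_snd (by fun_prop)).div
          ((hf.measurable_apply θ₀ n).comp (by fun_prop))).coe_nnreal_ennreal
    have hstep : ∀ ω, (∫⁻ θ, (likelihoodRatio f θ₀ (n + 1) (fun i => Y i ω) θ : ℝ≥0∞) ∂ν)
        ^ (1 / 2 : ℝ) = F (fun i => Y i ω) (Y n ω) := fun ω => by
      simp only [F, ← hL]
      simp only [likelihoodRatio, Finset.prod_range_succ, ENNReal.coe_mul]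
    simp_rw [hstep]
    rw [lintegral_prefix_of_iIndepFun hY hindep n hF, hlaw n, Finset.sum_range_succ, Real.exp_add,
      ENNReal.ofReal_mul (Real.exp_pos _).le, ← mul_assoc]
    refine le_trans ?_ (mul_le_mul_left ih _)
    have hroot : Measurable fun ω => (∫⁻ θ, (likelihoodRatio f θ₀ n (fun i => Y i ω) θ : ℝ≥0∞) ∂ν)
        ^ (1 / 2 : ℝ) :=
      (hf.measurable_likelihoodRatio hY n).coe_nnreal_ennreal.lintegral_prod_right'.pow_const _
    rw [← lintegral_mul_const _ hroot]
    refine lintegral_mono fun ω => ?_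
    have hLω : Measurable fun θ => (L (fun i => Y i ω) θ : ℝ≥0∞) :=
      (hLm.comp measurable_prodMk_left).coe_nnreal_ennreal
    have hone := lintegral_sqrt_mixture_le (μ := μ n)
      (ν.withDensity fun θ => (L (fun i => Y i ω) θ : ℝ≥0∞))
      (hf.measurable n) (fun θ => hf.lintegral_eq_one θ n) (hf.measurable_apply θ₀ n)
      (hf.measurable_apply c n) (hf.lintegral_eq_one θ₀ n) (hf.lintegral_eq_one c n)
      ((withDensity_absolutelyContinuous _ _).ae_le (hδ n (by omega)))
    rw [withDensity_apply _ MeasurableSet.univ, Measure.restrict_univ] at hone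
    simp_rw [hL]
    refine le_trans (le_of_eq ?_) hone
    refine lintegral_congr fun y => ?_
    have hr : Measurable fun θ => ((f θ n y / f θ₀ n y : ℝ≥0) : ℝ≥0∞) :=
      ((hf.measurable_comp n measurable_id measurable_const).div
        measurable_const).coe_nnreal_ennreal
    rw [lintegral_withDensity_eq_lintegral_mul _ hLω hr]
    rfl

/-- A likelihood ratio has mean at most one. -/
lemma lintegral_likelihoodRatio_le (hf : IsDensityFamily μ f) (hY : ∀ i, Measurable (Y i))
    (hindep : iIndepFun Y P)
    (hlaw : ∀ i, P.map (Y i) = (μ i).withDensity fun y => (f θ₀ i y : ℝ≥0∞))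
    (n : ℕ) (θ : Θ) :
    ∫⁻ ω, (likelihoodRatio f θ₀ n (fun i => Y i ω) θ : ℝ≥0∞) ∂P ≤ 1 := by
  have hm : ∀ i, Measurable fun y => ((f θ i y / f θ₀ i y : ℝ≥0) : ℝ≥0∞) := fun i =>
    ((hf.measurable_apply θ i).div (hf.measurable_apply θ₀ i)).coe_nnreal_ennreal
  simp only [likelihoodRatio, ENNReal.ofNNReal_finsetProd]
  rw [lintegral_prod_eq_prod_lintegral_of_indepFun (Finset.range n)
    (fun i ω => ((f θ i (Y i ω) / f θ₀ i (Y i ω) : ℝ≥0) : ℝ≥0∞))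
    (hindep.comp (fun i y => ((f θ i y / f θ₀ i y : ℝ≥0) : ℝ≥0∞)) hm)
    (fun i => (hm i).comp (hY i))]
  refine Finset.prod_le_one (fun _ _ => zero_le) fun i _ => ?_
  rw [← lintegral_map (hm i) (hY i), hlaw i, lintegral_withDensity_eq_lintegral_mul _
    (hf.measurable_apply θ₀ i).coe_nnreal_ennreal (hm i), ← hf.lintegral_eq_one θ i]
  refine lintegral_mono fun y => ?_
  simp only [Pi.mul_apply]
  norm_cast
  rcases eq_or_ne (f θ₀ i y) 0 with h | h
  · simp [h]
  · rw [mul_div_cancel₀ _ h]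

lemma lintegral_lintegral_likelihoodRatio_le [SFinite P] (hf : IsDensityFamily μ f)
    (hY : ∀ i, Measurable (Y i)) (hindep : iIndepFun Y P)
    (hlaw : ∀ i, P.map (Y i) = (μ i).withDensity fun y => (f θ₀ i y : ℝ≥0∞))
    (ν : Measure Θ) [IsFiniteMeasure ν] (n : ℕ) :
    ∫⁻ ω, ∫⁻ θ, (likelihoodRatio f θ₀ n (fun i => Y i ω) θ : ℝ≥0∞) ∂ν ∂P ≤ ν Set.univ := by
  rw [lintegral_lintegral_swap
    (hf.measurable_likelihoodRatio hY n).coe_nnreal_ennreal.aemeasurable]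
  calc _ ≤ ∫⁻ _ : Θ, 1 ∂ν :=
        lintegral_mono fun θ => lintegral_likelihoodRatio_le hf hY hindep hlaw n θ
    _ = _ := by simp

end Model

/-! ### Kullback–Leibler neighbourhoods and the evidence -/

lemma measurable_ereal_abs : Measurable EReal.abs :=
  EReal.measurable_of_measurable_real <| by
    simp only [EReal.abs_def]
    fun_prop

section KullbackLeibler

variable {𝓨 : Type*} [MeasurableSpace 𝓨] {μ : Measure 𝓨} {p g : 𝓨 → ℝ≥0}

lemma abs_log_div_coe {a b : ℝ≥0} (ha : a ≠ 0) (hb : b ≠ 0) :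
    (ENNReal.log ((a : ℝ≥0∞) / (b : ℝ≥0∞))).abs = ‖Real.log (a / b)‖ₑ := by
  rw [← ENNReal.coe_div hb, ENNReal.log_of_nnreal (div_ne_zero ha hb), EReal.abs_def,
    Real.enorm_eq_ofReal_abs, NNReal.coe_div]

lemma ae_eq_zero_of_klSecondMoment_ne_top (hp : Measurable p) (hg : Measurable g)
    (hV : klSecondMoment μ p g ≠ ∞) : ∀ᵐ y ∂μ, g y = 0 → p y = 0 := by
  have hm : Measurable fun y => (ENNReal.log ((p y : ℝ≥0∞) / (g y : ℝ≥0∞))).abs ^ 2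
      * (p y : ℝ≥0∞) :=
    ((measurable_ereal_abs.comp (by fun_prop)).pow_const 2).mul hp.coe_nnreal_ennreal
  filter_upwards [ae_lt_top hm hV] with y hy hgy
  by_contra hpy
  have hpy' : (p y : ℝ≥0∞) ≠ 0 := by simpa using hpy
  simp [hgy, ENNReal.div_zero hpy', ENNReal.top_mul hpy'] at hy

lemma ae_ne_zero_withDensity (hp : Measurable p) (hg : Measurable g)
    (hV : klSecondMoment μ p g ≠ ∞) :
    ∀ᵐ y ∂(μ.withDensity fun y => (p y : ℝ≥0∞)), p y ≠ 0 ∧ g y ≠ 0 := by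
  rw [ae_withDensity_iff hp.coe_nnreal_ennreal]
  filter_upwards [ae_eq_zero_of_klSecondMoment_ne_top hp hg hV] with y hy hpy
  have hpy' : p y ≠ 0 := by simpa using hpy
  exact ⟨hpy', fun h => hpy' (hy h)⟩

lemma lintegral_sq_log_div (hp : Measurable p) (hg : Measurable g)
    (hV : klSecondMoment μ p g ≠ ∞) :
    ∫⁻ y, ‖Real.log (p y / g y)‖ₑ ^ 2 ∂(μ.withDensity fun y => (p y : ℝ≥0∞))
      = klSecondMoment μ p g := by
  rw [lintegral_withDensity_eq_lintegral_mul _ hp.coe_nnreal_ennreal (by fun_prop), klSecondMoment]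
  refine lintegral_congr_ae ?_
  filter_upwards [ae_eq_zero_of_klSecondMoment_ne_top hp hg hV] with y hy
  simp only [Pi.mul_apply]
  rcases eq_or_ne (p y) 0 with h | h
  · simp [h]
  · rw [abs_log_div_coe h fun h' => h (hy h'), mul_comm]

lemma memLp_log_div (hp : Measurable p) (hg : Measurable g) (hV : klSecondMoment μ p g ≠ ∞) :
    MemLp (fun y => Real.log (p y / g y)) 2 (μ.withDensity fun y => (p y : ℝ≥0∞)) := by
  have hm : Measurable fun y => Real.log (p y / g y) := by fun_prop
  refine ⟨hm.aestronglyMeasurable, ?_⟩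
  rw [eLpNorm_lt_top_iff_lintegral_rpow_enorm_lt_top (by norm_num) (by norm_num)]
  simp only [ENNReal.toReal_ofNat, ENNReal.rpow_ofNat]
  rw [lintegral_sq_log_div hp hg hV]
  exact hV.lt_top

lemma integral_sq_log_div (hp : Measurable p) (hg : Measurable g)
    (hV : klSecondMoment μ p g ≠ ∞) :
    ∫ y, Real.log (p y / g y) ^ 2 ∂(μ.withDensity fun y => (p y : ℝ≥0∞))
      = (klSecondMoment μ p g).toReal := by
  rw [integral_eq_lintegral_of_nonneg_ae (ae_of_all _ fun y => sq_nonneg _)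
    (Measurable.aestronglyMeasurable (by fun_prop)), ← lintegral_sq_log_div hp hg hV]
  congr 1
  refine lintegral_congr fun y => ?_
  rw [Real.enorm_eq_ofReal_abs, ← ENNReal.ofReal_pow (abs_nonneg _), sq_abs]

/-- Where `V(p, g)` is finite, the Kullback–Leibler divergence is the integral of the logarithm of
the ratio of the densities. -/
lemma klDensity_eq_ofReal [SigmaFinite μ] (hp : Measurable p) (hg : Measurable g)
    (hp1 : ∫⁻ y, (p y : ℝ≥0∞) ∂μ = 1) (hg1 : ∫⁻ y, (g y : ℝ≥0∞) ∂μ = 1)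
    (hV : klSecondMoment μ p g ≠ ∞) :
    klDensity μ p g
      = ENNReal.ofReal (∫ y, Real.log (p y / g y) ∂(μ.withDensity fun y => (p y : ℝ≥0∞))) := by
  set Q := μ.withDensity fun y => (p y : ℝ≥0∞) with hQ
  set G := μ.withDensity fun y => (g y : ℝ≥0∞) with hG
  have hQ1 : IsProbabilityMeasure Q :=
    ⟨by rw [hQ, withDensity_apply _ MeasurableSet.univ, Measure.restrict_univ, hp1]⟩
  have hG1 : IsProbabilityMeasure G :=
    ⟨by rw [hG, withDensity_apply _ MeasurableSet.univ, Measure.restrict_univ, hg1]⟩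
  have hr : Measurable fun y => ((p y / g y : ℝ≥0) : ℝ≥0∞) := by fun_prop
  have hQG : Q = G.withDensity fun y => ((p y / g y : ℝ≥0) : ℝ≥0∞) := by
    rw [hG, ← withDensity_mul _ hg.coe_nnreal_ennreal hr]
    refine withDensity_congr_ae ?_
    filter_upwards [ae_eq_zero_of_klSecondMoment_ne_top hp hg hV] with y hy
    simp only [Pi.mul_apply]
    norm_cast
    rcases eq_or_ne (g y) 0 with h | h
    · simp [h, hy h]
    · rw [mul_div_cancel₀ _ h]
  have hac : Q ≪ G := hQG ▸ withDensity_absolutelyContinuous _ _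
  have hllr : llr Q G =ᵐ[Q] fun y => Real.log (p y / g y) := by
    have h := hac.ae_le (Measure.rnDeriv_withDensity G hr)
    rw [← hQG] at h
    filter_upwards [h] with y hy
    simp [llr, hy]
  have hint : Integrable (llr Q G) Q :=
    ((memLp_log_div hp hg hV).integrable one_le_two).congr hllr.symm
  rw [← integral_congr_ae hllr, ← toReal_klDiv_of_measure_eq hac (by simp),
    ENNReal.ofReal_toReal (klDiv_ne_top hac hint), klDensity]

end KullbackLeibler

section Evidence

variable {Ω : Type*} [MeasurableSpace Ω] {P : Measure Ω}
  {𝓨 : ℕ → Type*} [∀ i, MeasurableSpace (𝓨 i)] {μ : ∀ i, Measure (𝓨 i)} [∀ i, SigmaFinite (μ i)]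
  {Θ : Type*} [MeasurableSpace Θ] {f : Θ → ∀ i, 𝓨 i → ℝ≥0} {θ₀ : Θ} {Y : ∀ i, Ω → 𝓨 i}

/-- Chebyshev's inequality for the logarithm of the likelihood ratio at a parameter in a
Kullback–Leibler neighbourhood of the true one. -/
lemma measure_likelihoodRatio_lt_le (hf : IsDensityFamily μ f) (hY : ∀ i, Measurable (Y i))
    (hindep : iIndepFun Y P)
    (hlaw : ∀ i, P.map (Y i) = (μ i).withDensity fun y => (f θ₀ i y : ℝ≥0∞))
    (n : ℕ) (θ : Θ) {T d : ℝ} (hT : 0 < T) (hd : 0 < d)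
    (hK : ∑ i ∈ Finset.range n, klDensity (μ i) (f θ₀ i) (f θ i) ≤ ENNReal.ofReal T)
    (hV : ∑ i ∈ Finset.range n, klSecondMoment (μ i) (f θ₀ i) (f θ i) ≤ ENNReal.ofReal T) :
    P {ω | (likelihoodRatio f θ₀ n (fun i => Y i ω) θ : ℝ≥0∞)
        < ENNReal.ofReal (Real.exp (-((1 + d) * T)))}
      ≤ ENNReal.ofReal (1 / (d ^ 2 * T)) := by
  have := hindep.isProbabilityMeasure
  have hVi : ∀ i ∈ Finset.range n, klSecondMoment (μ i) (f θ₀ i) (f θ i) ≠ ∞ := fun i hi =>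
    ((Finset.single_le_sum (fun _ _ => zero_le) hi).trans hV).trans_lt
      ENNReal.ofReal_lt_top |>.ne
  let ℓ : ∀ i, 𝓨 i → ℝ := fun i y => Real.log (f θ₀ i y / f θ i y)
  have hℓ : ∀ i, Measurable (ℓ i) := fun i => by
    have := hf.measurable_apply θ₀ i
    have := hf.measurable_apply θ i
    fun_prop
  let X : ℕ → Ω → ℝ := fun i ω => ℓ i (Y i ω)
  have hXL : ∀ i ∈ Finset.range n, MemLp (X i) 2 P := fun i hi => by
    have := memLp_log_div (hf.measurable_apply θ₀ i) (hf.measurable_apply θ i) (hVi i hi)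
    rw [← hlaw i] at this
    exact this.comp_of_map (hY i).aemeasurable
  have hXindep : iIndepFun X P := hindep.comp ℓ hℓ
  have hmean : ∑ i ∈ Finset.range n, P[X i] ≤ T := by
    have h1 : ∀ i ∈ Finset.range n, ENNReal.ofReal (P[X i])
        = klDensity (μ i) (f θ₀ i) (f θ i) := fun i hi => by
      rw [klDensity_eq_ofReal (hf.measurable_apply θ₀ i) (hf.measurable_apply θ i)
        (hf.lintegral_eq_one θ₀ i) (hf.lintegral_eq_one θ i) (hVi i hi), ← hlaw i,
        integral_map (hY i).aemeasurable (hℓ i).aestronglyMeasurable]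
    rw [← Finset.sum_congr rfl h1] at hK
    have h2 : (∑ i ∈ Finset.range n, ENNReal.ofReal (P[X i])).toReal ≤ T :=
      ENNReal.toReal_le_of_le_ofReal hT.le hK
    rw [ENNReal.toReal_sum (by simp)] at h2
    refine (Finset.sum_le_sum fun i _ => ?_).trans h2
    rw [ENNReal.toReal_ofReal']
    exact le_max_left _ _
  have hvar : Var[∑ i ∈ Finset.range n, X i; P] ≤ T := by
    rw [IndepFun.variance_sum hXL fun i _ j _ hij => hXindep.indepFun hij]
    have h2 : (∑ i ∈ Finset.range n, klSecondMoment (μ i) (f θ₀ i) (f θ i)).toReal ≤ T :=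
      ENNReal.toReal_le_of_le_ofReal hT.le hV
    rw [ENNReal.toReal_sum hVi] at h2
    refine (Finset.sum_le_sum fun i hi => ?_).trans h2
    rw [← integral_sq_log_div (hf.measurable_apply θ₀ i) (hf.measurable_apply θ i) (hVi i hi),
      ← hlaw i, integral_map (hY i).aemeasurable ((hℓ i).pow_const 2).aestronglyMeasurable]
    exact variance_le_expectation_sq ((hℓ i).comp (hY i)).aestronglyMeasurable
  have hpos : ∀ᵐ ω ∂P, ∀ i ∈ Finset.range n, f θ₀ i (Y i ω) ≠ 0 ∧ f θ i (Y i ω) ≠ 0 := by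
    refine (Finset.eventually_all _).2 fun i hi => ?_
    have := ae_ne_zero_withDensity (hf.measurable_apply θ₀ i) (hf.measurable_apply θ i) (hVi i hi)
    rw [← hlaw i] at this
    exact ae_of_ae_map (hY i).aemeasurable this
  have hS : MemLp (∑ i ∈ Finset.range n, X i) 2 P := memLp_finsetSum' _ hXL
  calc P {ω | (likelihoodRatio f θ₀ n (fun i => Y i ω) θ : ℝ≥0∞)
        < ENNReal.ofReal (Real.exp (-((1 + d) * T)))}
      ≤ P {ω | d * T ≤ |(∑ i ∈ Finset.range n, X i) ω - P[∑ i ∈ Finset.range n, X i]|} := by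
        refine measure_mono_ae ?_
        filter_upwards [hpos] with ω hω hlt
        have hR : (likelihoodRatio f θ₀ n (fun i => Y i ω) θ : ℝ≥0∞)
            = ENNReal.ofReal (Real.exp (-∑ i ∈ Finset.range n, X i ω)) := by
          rw [← ENNReal.ofReal_coe_nnreal, likelihoodRatio, ← Finset.sum_neg_distrib, Real.exp_sum,
            NNReal.coe_prod]
          congr 1
          refine Finset.prod_congr rfl fun i hi => ?_
          obtain ⟨h0, h1⟩ := hω i hi
          have h0' : 0 < (f θ₀ i (Y i ω) : ℝ) := by positivity
          have h1' : 0 < (f θ i (Y i ω) : ℝ) := by positivity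
          simp only [X, ℓ]
          rw [← Real.log_inv, inv_div, Real.exp_log (by positivity), NNReal.coe_div]
        have hlt' : (likelihoodRatio f θ₀ n (fun i => Y i ω) θ : ℝ≥0∞)
          < ENNReal.ofReal (Real.exp (-((1 + d) * T))) := hlt
        rw [hR, ENNReal.ofReal_lt_ofReal_iff (Real.exp_pos _), Real.exp_lt_exp] at hlt'
        have hE : P[∑ i ∈ Finset.range n, X i] = ∑ i ∈ Finset.range n, P[X i] := by
          simp only [Finset.sum_apply]
          exact integral_finsetSum _ fun i hi => (hXL i hi).integrable one_le_two
        change d * T ≤ |_|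
        rw [hE, Finset.sum_apply]
        refine le_trans ?_ (le_abs_self _)
        linarith
    _ ≤ ENNReal.ofReal (Var[∑ i ∈ Finset.range n, X i; P] / (d * T) ^ 2) :=
        meas_ge_le_variance_div_sq hS (by positivity)
    _ ≤ ENNReal.ofReal (1 / (d ^ 2 * T)) := by
        refine ENNReal.ofReal_le_ofReal ?_
        rw [div_le_div_iff₀ (by positivity) (by positivity)]
        calc _ ≤ T * (d ^ 2 * T) := by gcongr
          _ = _ := by ring

lemma IsDensityFamily.measurable_klSecondMoment (hf : IsDensityFamily μ f) (i : ℕ) :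
    Measurable fun θ => klSecondMoment (μ i) (f θ₀ i) (f θ i) := by
  have h0 : Measurable fun x : Θ × 𝓨 i => (f θ₀ i x.2 : ℝ≥0∞) :=
    ((hf.measurable_apply θ₀ i).comp measurable_snd).coe_nnreal_ennreal
  exact Measurable.lintegral_prod_right' (f := fun x : Θ × 𝓨 i =>
    (ENNReal.log ((f θ₀ i x.2 : ℝ≥0∞) / (f x.1 i x.2 : ℝ≥0∞))).abs ^ 2 * (f θ₀ i x.2 : ℝ≥0∞))
    (((measurable_ereal_abs.comp
      (h0.div (hf.measurable i).coe_nnreal_ennreal).ennreal_log).pow_const 2).mul h0)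

/-- Kullback–Leibler neighbourhoods are measurable: since `V` is finite on them, the divergence can
be replaced by an integral which depends measurably on the parameter. -/
lemma IsDensityFamily.measurableSet_klBall (hf : IsDensityFamily μ f) (n : ℕ) (T : ℝ) :
    MeasurableSet {θ | ∑ i ∈ Finset.range n, klDensity (μ i) (f θ₀ i) (f θ i) ≤ ENNReal.ofReal T ∧
      ∑ i ∈ Finset.range n, klSecondMoment (μ i) (f θ₀ i) (f θ i) ≤ ENNReal.ofReal T} := by
  let I : ℕ → Θ → ℝ := fun i θ => ∫ y, Real.log (f θ₀ i y / f θ i y)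
    ∂((μ i).withDensity fun y => (f θ₀ i y : ℝ≥0∞))
  have hI : ∀ i, Measurable (I i) := fun i => by
    have h0 : Measurable fun x : Θ × 𝓨 i => f θ₀ i x.2 :=
      (hf.measurable_apply θ₀ i).comp measurable_snd
    have h1 := hf.measurable i
    have hm : Measurable fun x : Θ × 𝓨 i => Real.log (f θ₀ i x.2 / f x.1 i x.2) := by fun_prop
    exact hm.stronglyMeasurable.integral_prod_right'.measurable
  have hVm : Measurable fun θ => ∑ i ∈ Finset.range n, klSecondMoment (μ i) (f θ₀ i) (f θ i) :=
    Finset.measurable_fun_sum _ fun i _ => hf.measurable_klSecondMoment i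
  have hIm : Measurable fun θ => ∑ i ∈ Finset.range n, ENNReal.ofReal (I i θ) :=
    Finset.measurable_fun_sum _ fun i _ => (hI i).ennreal_ofReal
  convert (measurableSet_le hIm (measurable_const (a := ENNReal.ofReal T))).inter
    (measurableSet_le hVm (measurable_const (a := ENNReal.ofReal T))) using 1
  ext θ
  refine and_congr_left fun hV => ?_
  rw [Finset.sum_congr rfl fun i hi => klDensity_eq_ofReal (hf.measurable_apply θ₀ i)
    (hf.measurable_apply θ i) (hf.lintegral_eq_one θ₀ i) (hf.lintegral_eq_one θ i)
    (((Finset.single_le_sum (fun _ _ => zero_le) hi).trans hV).trans_lt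
      ENNReal.ofReal_lt_top).ne]
  rfl

/-- Lower bound for the evidence. By Chebyshev's inequality and Fubini's theorem the expected prior
mass of the parameters in the Kullback–Leibler neighbourhood `B` with a small likelihood ratio is a
small fraction of that of `B`; by Markov's inequality, half of `B` has a large likelihood ratio with
high probability. -/
lemma measure_evidence_lt_le (hf : IsDensityFamily μ f) (hY : ∀ i, Measurable (Y i))
    (hindep : iIndepFun Y P)
    (hlaw : ∀ i, P.map (Y i) = (μ i).withDensity fun y => (f θ₀ i y : ℝ≥0∞))
    (prior : Measure Θ) [IsFiniteMeasure prior] (n : ℕ) {T d : ℝ} (hT : 0 < T) (hd : 0 < d)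
    {B : Set Θ} (hB : B = {θ |
      ∑ i ∈ Finset.range n, klDensity (μ i) (f θ₀ i) (f θ i) ≤ ENNReal.ofReal T ∧
      ∑ i ∈ Finset.range n, klSecondMoment (μ i) (f θ₀ i) (f θ i) ≤ ENNReal.ofReal T}) :
    P {ω | ∫⁻ θ, (likelihoodRatio f θ₀ n (fun i => Y i ω) θ : ℝ≥0∞) ∂prior
        < ENNReal.ofReal (Real.exp (-((1 + d) * T))) * (prior B / 2)}
      ≤ ENNReal.ofReal (1 / (d ^ 2 * T)) * 2 := by
  have := hindep.isProbabilityMeasure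
  have hBm : MeasurableSet B := hB ▸ hf.measurableSet_klBall n T
  rcases eq_or_ne (prior B) 0 with h0 | h0
  · simp [h0]
  set e := ENNReal.ofReal (Real.exp (-((1 + d) * T)))
  have hR := (hf.measurable_likelihoodRatio (θ₀ := θ₀) hY n).coe_nnreal_ennreal
  let bad : Set (Ω × Θ) := {x | (likelihoodRatio f θ₀ n (fun i => Y i x.1) x.2 : ℝ≥0∞) < e}
  have hbad : MeasurableSet bad := measurableSet_lt hR measurable_const
  let G : Ω → ℝ≥0∞ := fun ω => prior.restrict B (Prod.mk ω ⁻¹' bad)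
  have hG : Measurable G := measurable_measure_prodMk_left hbad
  have hEG : ∫⁻ ω, G ω ∂P ≤ ENNReal.ofReal (1 / (d ^ 2 * T)) * prior B := by
    calc ∫⁻ ω, G ω ∂P = (P.prod (prior.restrict B)) bad := (Measure.prod_apply hbad).symm
      _ = ∫⁻ θ in B, P ((fun ω => (ω, θ)) ⁻¹' bad) ∂prior := Measure.prod_apply_symm hbad
      _ ≤ ∫⁻ _ in B, ENNReal.ofReal (1 / (d ^ 2 * T)) ∂prior := by
        refine setLIntegral_mono measurable_const fun θ hθ => ?_
        rw [hB] at hθ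
        exact measure_likelihoodRatio_lt_le hf hY hindep hlaw n θ hT hd hθ.1 hθ.2
      _ = _ := by rw [setLIntegral_const]
  have hsub : {ω | ∫⁻ θ, (likelihoodRatio f θ₀ n (fun i => Y i ω) θ : ℝ≥0∞) ∂prior
      < e * (prior B / 2)} ⊆ {ω | prior B / 2 ≤ G ω} := by
    intro ω hω
    by_contra hcon
    have hcon' : G ω < prior B / 2 := not_le.1 hcon
    rw [Set.mem_ofPred_eq] at hω
    refine absurd hω (not_lt.2 ?_)
    have hsec : MeasurableSet (Prod.mk ω ⁻¹' bad) := measurable_prodMk_left hbad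
    have hhalf : prior B / 2 ≤ prior.restrict B (Prod.mk ω ⁻¹' bad)ᶜ := by
      by_contra hlt
      have hadd := measure_add_measure_compl (μ := prior.restrict B) hsec
      rw [Measure.restrict_apply_univ] at hadd
      refine absurd hadd (ne_of_lt ?_)
      calc _ < prior B / 2 + prior B / 2 := ENNReal.add_lt_add hcon' (not_le.1 hlt)
        _ = prior B := ENNReal.add_halves _
    calc e * (prior B / 2) ≤ e * prior.restrict B (Prod.mk ω ⁻¹' bad)ᶜ := by gcongr
      _ = ∫⁻ _ in (Prod.mk ω ⁻¹' bad)ᶜ, e ∂(prior.restrict B) := by rw [setLIntegral_const]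
      _ ≤ ∫⁻ θ in (Prod.mk ω ⁻¹' bad)ᶜ,
          (likelihoodRatio f θ₀ n (fun i => Y i ω) θ : ℝ≥0∞) ∂(prior.restrict B) := by
        refine setLIntegral_mono (hR.comp measurable_prodMk_left) fun θ hθ => ?_
        exact not_lt.1 hθ
      _ ≤ ∫⁻ θ, (likelihoodRatio f θ₀ n (fun i => Y i ω) θ : ℝ≥0∞) ∂(prior.restrict B) :=
        setLIntegral_le_lintegral _ _
      _ ≤ _ := setLIntegral_le_lintegral _ _
  refine (measure_mono hsub).trans ?_
  have hmarkov := meas_ge_le_lintegral_div hG.aemeasurable (μ := P) (ε := prior B / 2)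
    (by simpa using h0) (by finiteness)
  refine hmarkov.trans ?_
  refine ENNReal.div_le_of_le_mul (hEG.trans (le_of_eq ?_))
  rw [mul_assoc, ENNReal.mul_div_cancel (by norm_num) (by norm_num)]

end Evidence

/-! ### Coverings by Hellinger balls and the posterior -/

/-- A covering number which is at most `exp a` yields a finite set of centres of at most that
cardinality. -/
lemma exists_finset_of_log_ballCoveringNumber_le {X : Type*} {d : X → X → ℝ} {δ : ℝ} {A : Set X}
    {a : ℝ} (h : ENNReal.log (ballCoveringNumber d δ A : ℝ≥0∞) ≤ (a : EReal)) :
    ∃ S : Finset X, A ⊆ ⋃ c ∈ S, {x | d c x ≤ δ} ∧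
      (S.card : ℝ≥0∞) ≤ ENNReal.ofReal (Real.exp a) := by
  have h1 : (ballCoveringNumber d δ A : ℝ≥0∞) ≤ ENNReal.ofReal (Real.exp a) := by
    rw [← ENNReal.log_le_log_iff, ENNReal.log_ofReal_of_pos (Real.exp_pos a), Real.log_exp]
    exact h
  have h2 : ballCoveringNumber d δ A ≠ ⊤ := by
    intro htop
    rw [htop] at h1
    simp at h1
  obtain ⟨S, hS⟩ := iInf_lt_iff.1 (ENat.lt_add_one_iff h2 |>.2 le_rfl : ballCoveringNumber d δ A <
    ballCoveringNumber d δ A + 1)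
  obtain ⟨hcov, hcard⟩ := iInf_lt_iff.1 hS
  have hle : S.encard ≤ ballCoveringNumber d δ A := (ENat.lt_add_one_iff h2).1 hcard
  have hfin : S.Finite := Set.finite_of_encard_le_coe (hle.trans (ENat.natCast_toNat h2).ge)
  refine ⟨hfin.toFinset, by simpa using hcov, le_trans ?_ h1⟩
  rw [hfin.encard_eq_coe_toFinset_card] at hle
  exact_mod_cast ENat.toENNReal_le.2 hle

section Model

variable {Ω : Type*} [MeasurableSpace Ω] {P : Measure Ω}
  {𝓨 : ℕ → Type*} [∀ i, MeasurableSpace (𝓨 i)] {μ : ∀ i, Measure (𝓨 i)}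
  {Θ : Type*} {f : Θ → ∀ i, 𝓨 i → ℝ≥0} {θ₀ : Θ} {Y : ∀ i, Ω → 𝓨 i}

lemma meanHellinger_sq (n : ℕ) (θ₁ θ₂ : Θ) :
    meanHellinger μ f n θ₁ θ₂ ^ 2
      = (1 / (n : ℝ)) * ∑ i ∈ Finset.range n, hellingerDist (μ i) (f θ₁ i) (f θ₂ i) ^ 2 :=
  Real.sq_sqrt (by positivity)

lemma hellingerDist_le_maxHellinger {n i : ℕ} (hi : i < n) (θ₁ θ₂ : Θ) :
    hellingerDist (μ i) (f θ₁ i) (f θ₂ i) ≤ maxHellinger μ f n θ₁ θ₂ :=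
  le_ciSup (f := fun i : Fin n => hellingerDist (μ i) (f θ₁ i) (f θ₂ i))
    (Set.finite_range _).bddAbove ⟨i, hi⟩

variable [MeasurableSpace Θ]

/-- If a max-Hellinger ball meets the set of parameters at mean Hellinger distance at least `M ε`
from `θ₀`, then its centre is itself at a distance of order `M ε`. -/
lemma IsDensityFamily.le_sum_hellingerDist_sq (hf : IsDensityFamily μ f) {n : ℕ} (hn : n ≠ 0)
    {M ε : ℝ} (hM : 0 ≤ M) (hε : 0 ≤ ε) {c θ : Θ}
    (hc : ∀ i < n, hellingerDist (μ i) (f c i) (f θ i) ≤ ε)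
    (hθ : M * ε ≤ meanHellinger μ f n θ₀ θ) :
    (M ^ 2 / 2 - 1) * (n * ε ^ 2)
      ≤ ∑ i ∈ Finset.range n, hellingerDist (μ i) (f θ₀ i) (f c i) ^ 2 := by
  have hn' : (0 : ℝ) < n := by positivity
  have h1 : (M * ε) ^ 2 ≤ meanHellinger μ f n θ₀ θ ^ 2 := by gcongr
  rw [meanHellinger_sq, one_div, inv_mul_eq_div, le_div_iff₀ hn'] at h1
  have h2 : ∑ i ∈ Finset.range n, hellingerDist (μ i) (f θ₀ i) (f θ i) ^ 2
      ≤ ∑ i ∈ Finset.range n, (2 * hellingerDist (μ i) (f θ₀ i) (f c i) ^ 2 + 2 * ε ^ 2) := by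
    refine Finset.sum_le_sum fun i hi => ?_
    have := hellingerDist_sq_le_add (hf.measurable_apply θ₀ i) (hf.measurable_apply c i)
      (hf.measurable_apply θ i) (hf.lintegral_eq_one θ₀ i) (hf.lintegral_eq_one c i)
      (hf.lintegral_eq_one θ i)
    have h3 : hellingerDist (μ i) (f c i) (f θ i) ^ 2 ≤ ε ^ 2 :=
      pow_le_pow_left₀ (hellingerDist_nonneg _ _) (hc i (Finset.mem_range.1 hi)) 2
    linarith
  rw [Finset.sum_add_distrib, ← Finset.mul_sum, Finset.sum_const, Finset.card_range,
    nsmul_eq_mul] at h2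
  nlinarith

variable [∀ i, SigmaFinite (μ i)]

lemma IsDensityFamily.measurable_hellingerDist (hf : IsDensityFamily μ f) (c : Θ) (i : ℕ) :
    Measurable fun θ => hellingerDist (μ i) (f c i) (f θ i) := by
  have h0 : Measurable fun x : Θ × 𝓨 i => f c i x.2 :=
    (hf.measurable_apply c i).comp measurable_snd
  have h1 := hf.measurable i
  have hm : Measurable fun x : Θ × 𝓨 i => (√(f c i x.2 : ℝ) - √(f x.1 i x.2 : ℝ)) ^ 2 := by fun_prop
  exact (hm.stronglyMeasurable.integral_prod_right'.measurable).sqrt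

lemma le_rpow_half_of_le_one {x : ℝ≥0∞} (hx : x ≤ 1) : x ≤ x ^ (1 / 2 : ℝ) := by
  simpa using ENNReal.rpow_le_rpow_of_exponent_ge hx (by norm_num : (1 / 2 : ℝ) ≤ 1)

lemma setLIntegral_biUnion_finset_le {ι : Type*} (ν : Measure Θ) (L : Θ → ℝ≥0∞) (S : Finset ι)
    (A : ι → Set Θ) :
    ∫⁻ θ in ⋃ c ∈ S, A c, L θ ∂ν ≤ ∑ c ∈ S, ∫⁻ θ in A c, L θ ∂ν := by
  classical
  induction S using Finset.induction_on with
  | empty => simp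
  | insert c S hc ih =>
    rw [Finset.set_biUnion_insert, Finset.sum_insert hc]
    exact (lintegral_union_le _ _ _).trans (by gcongr)

/-- Deterministic bound for a posterior probability: each cell of the cover has posterior
probability at most one, which is therefore bounded by its own square root. -/
lemma setLIntegral_div_le_add_sum {ι : Type*} (ν : Measure Θ) (L : Θ → ℝ≥0∞) (S : Finset ι)
    {B V : Set Θ} {A : ι → Set Θ} (hB : B ⊆ V ∪ ⋃ c ∈ S, A c) {D : ℝ≥0∞}
    (hD : D ≤ ∫⁻ θ, L θ ∂ν) :
    (∫⁻ θ in B, L θ ∂ν) / ∫⁻ θ, L θ ∂ν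
      ≤ (∫⁻ θ in V, L θ ∂ν) / D
        + ∑ c ∈ S, (∫⁻ θ in A c, L θ ∂ν) ^ (1 / 2 : ℝ) / D ^ (1 / 2 : ℝ) := by
  set E := ∫⁻ θ, L θ ∂ν
  have h1 : ∫⁻ θ in B, L θ ∂ν ≤ ∫⁻ θ in V, L θ ∂ν + ∑ c ∈ S, ∫⁻ θ in A c, L θ ∂ν := by
    refine (lintegral_mono_set hB).trans ((lintegral_union_le _ _ _).trans ?_)
    gcongr
    exact setLIntegral_biUnion_finset_le ν L S A
  have h2 : ∀ c, (∫⁻ θ in A c, L θ ∂ν) / E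
      ≤ (∫⁻ θ in A c, L θ ∂ν) ^ (1 / 2 : ℝ) / D ^ (1 / 2 : ℝ) := fun c =>
    calc (∫⁻ θ in A c, L θ ∂ν) / E ≤ ((∫⁻ θ in A c, L θ ∂ν) / E) ^ (1 / 2 : ℝ) :=
          le_rpow_half_of_le_one (ENNReal.div_le_of_le_mul (by
            rw [one_mul]; exact setLIntegral_le_lintegral _ _))
      _ = (∫⁻ θ in A c, L θ ∂ν) ^ (1 / 2 : ℝ) / E ^ (1 / 2 : ℝ) :=
          ENNReal.div_rpow_of_nonneg _ _ (by norm_num)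
      _ ≤ _ := by gcongr
  calc (∫⁻ θ in B, L θ ∂ν) / E
      ≤ (∫⁻ θ in V, L θ ∂ν + ∑ c ∈ S, ∫⁻ θ in A c, L θ ∂ν) / E := by gcongr
    _ = (∫⁻ θ in V, L θ ∂ν) / E + ∑ c ∈ S, (∫⁻ θ in A c, L θ ∂ν) / E := by
      simp only [div_eq_mul_inv, add_mul, Finset.sum_mul]
    _ ≤ _ := add_le_add (by gcongr) (Finset.sum_le_sum fun c _ => h2 c)

/-- Finite-sample bound for the posterior mass far from the true parameter, by Markov's inequality
from the mean of the bound in `setLIntegral_div_le_add_sum`. -/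
lemma measure_le_posteriorProb_le (hf : IsDensityFamily μ f) (hY : ∀ i, Measurable (Y i))
    (hindep : iIndepFun Y P)
    (hlaw : ∀ i, P.map (Y i) = (μ i).withDensity fun y => (f θ₀ i y : ℝ≥0∞))
    (prior : Measure Θ) [IsProbabilityMeasure prior] {n : ℕ} (hn : n ≠ 0) {M ε : ℝ}
    (hM : 0 ≤ M) (hε : 0 ≤ ε) (sieve : Set Θ) (S : Finset Θ)
    (hS : sieve ⊆ ⋃ c ∈ S, {θ | maxHellinger μ f n c θ ≤ ε}) (D : ℝ≥0∞)
    {η : ℝ≥0∞} (hη : η ≠ 0) (hη' : η ≠ ∞) :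
    P {ω | η ≤ edist (posteriorProb f prior θ₀ n (fun i => Y i ω)
        {θ | M * ε ≤ meanHellinger μ f n θ₀ θ}) 0}
      ≤ P {ω | ∫⁻ θ, (likelihoodRatio f θ₀ n (fun i => Y i ω) θ : ℝ≥0∞) ∂prior < D}
        + (prior sieveᶜ / D + S.card * ENNReal.ofReal (Real.exp
          ((3 / 4 - M ^ 2 / 8) * (n * ε ^ 2))) / D ^ (1 / 2 : ℝ)) / η := by
  classical
  have := hindep.isProbabilityMeasure
  let L : Ω → Θ → ℝ≥0∞ := fun ω θ => likelihoodRatio f θ₀ n (fun i => Y i ω) θ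
  have hL : Measurable fun x : Ω × Θ => L x.1 x.2 :=
    (hf.measurable_likelihoodRatio hY n).coe_nnreal_ennreal
  let A : Θ → Set Θ := fun c => {θ | ∀ i < n, hellingerDist (μ i) (f c i) (f θ i) ≤ ε}
  have hA : ∀ c, MeasurableSet (A c) := fun c => by
    have : A c = ⋂ i, ⋂ _ : i < n, {θ | hellingerDist (μ i) (f c i) (f θ i) ≤ ε} := by
      ext θ; simp [A]
    rw [this]
    exact MeasurableSet.iInter fun i => MeasurableSet.iInter fun _ =>
      measurableSet_le (hf.measurable_hellingerDist c i) measurable_const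
  -- Only the balls whose centre is far from `θ₀` matter.
  let S' := S.filter fun c => (M ^ 2 / 2 - 1) * (n * ε ^ 2)
      ≤ ∑ i ∈ Finset.range n, hellingerDist (μ i) (f θ₀ i) (f c i) ^ 2
  have hcov : {θ | M * ε ≤ meanHellinger μ f n θ₀ θ} ⊆ sieveᶜ ∪ ⋃ c ∈ S', A c := by
    intro θ hθ
    by_cases hs : θ ∈ sieve
    · right
      obtain ⟨c, hcS, hc⟩ := Set.mem_iUnion₂.1 (hS hs)
      have hcA : θ ∈ A c := fun i hi => (hellingerDist_le_maxHellinger hi c θ).trans hc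
      exact Set.mem_iUnion₂.2 ⟨c, Finset.mem_filter.2
        ⟨hcS, hf.le_sum_hellingerDist_sq hn hM hε hcA hθ⟩, hcA⟩
    · exact Or.inl hs
  let Z : Ω → ℝ≥0∞ := fun ω => (∫⁻ θ in sieveᶜ, L ω θ ∂prior) / D
    + ∑ c ∈ S', (∫⁻ θ in A c, L ω θ ∂prior) ^ (1 / 2 : ℝ) / D ^ (1 / 2 : ℝ)
  have hint : ∀ s : Set Θ, Measurable fun ω => ∫⁻ θ in s, L ω θ ∂prior := fun s =>
    hL.lintegral_prod_right'
  have hZ : Measurable Z :=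
    ((hint _).div_const _).add (Finset.measurable_fun_sum _ fun c _ =>
      ((hint _).pow_const _).div_const _)
  have hcell : ∀ c ∈ S', ∫⁻ ω, (∫⁻ θ in A c, L ω θ ∂prior) ^ (1 / 2 : ℝ) ∂P
      ≤ ENNReal.ofReal (Real.exp ((3 / 4 - M ^ 2 / 8) * (n * ε ^ 2))) := fun c hc => by
    refine (lintegral_sqrt_likelihoodRatio_le hf hY hindep hlaw (prior.restrict (A c)) c ε n
      fun i hi => (ae_restrict_of_forall_mem (hA c) fun θ hθ => hθ i hi)).trans ?_
    rw [Measure.restrict_apply_univ]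
    have h1 : prior (A c) ^ (1 / 2 : ℝ) ≤ 1 := ENNReal.rpow_le_one prob_le_one (by norm_num)
    refine (mul_le_mul_left h1 _).trans ?_
    rw [one_mul]
    gcongr
    rw [Finset.sum_add_distrib, Finset.sum_const, Finset.card_range, nsmul_eq_mul,
      Finset.sum_neg_distrib, ← Finset.sum_div]
    have := (Finset.mem_filter.1 hc).2
    linarith
  have hEZ : ∫⁻ ω, Z ω ∂P ≤ prior sieveᶜ / D + S.card * ENNReal.ofReal (Real.exp
      ((3 / 4 - M ^ 2 / 8) * (n * ε ^ 2))) / D ^ (1 / 2 : ℝ) := by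
    simp only [Z]
    rw [lintegral_add_left ((hint _).div_const _), lintegral_finsetSum _ fun c _ =>
      ((hint _).pow_const _).div_const _]
    have hdiv : ∀ {g : Ω → ℝ≥0∞} (k : ℝ≥0∞), Measurable g →
        ∫⁻ ω, g ω / k ∂P = (∫⁻ ω, g ω ∂P) / k := fun k hg => by
      simp only [div_eq_mul_inv]
      exact lintegral_mul_const _ hg
    rw [hdiv _ (hint _)]
    refine add_le_add (ENNReal.div_le_div_right ?_ _) ?_
    · refine (lintegral_lintegral_likelihoodRatio_le hf hY hindep hlaw
        (prior.restrict sieveᶜ) n).trans_eq ?_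
      rw [Measure.restrict_apply_univ]
    · calc _ ≤ ∑ c ∈ S', ENNReal.ofReal (Real.exp ((3 / 4 - M ^ 2 / 8) * (n * ε ^ 2)))
            / D ^ (1 / 2 : ℝ) := by
            refine Finset.sum_le_sum fun c hc => ?_
            rw [hdiv _ ((hint _).pow_const _)]
            exact ENNReal.div_le_div_right (hcell c hc) _
        _ ≤ _ := by
          rw [Finset.sum_const, nsmul_eq_mul, ← mul_div_assoc]
          gcongr
          exact Finset.filter_subset _ _
  have hsub : {ω | η ≤ edist (posteriorProb f prior θ₀ n (fun i => Y i ω)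
      {θ | M * ε ≤ meanHellinger μ f n θ₀ θ}) 0}
      ⊆ {ω | ∫⁻ θ, L ω θ ∂prior < D} ∪ {ω | η ≤ Z ω} := by
    intro ω hω
    rcases lt_or_ge (∫⁻ θ, L ω θ ∂prior) D with h | h
    · exact Or.inl h
    · refine Or.inr (le_trans (Set.mem_ofPred.1 hω) ?_)
      rw [edist_dist, dist_zero_right, posteriorProb, Real.norm_of_nonneg ENNReal.toReal_nonneg]
      exact ENNReal.ofReal_toReal_le.trans (setLIntegral_div_le_add_sum prior (L ω) S' hcov h)
  refine (measure_mono hsub).trans ((measure_union_le _ _).trans ?_)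
  gcongr
  refine (meas_ge_le_lintegral_div hZ.aemeasurable hη hη').trans ?_
  gcongr

end Model

/-! ### Posterior contraction -/

section Model

variable {Ω : Type*} [MeasurableSpace Ω] {P : Measure Ω}
  {𝓨 : ℕ → Type*} [∀ i, MeasurableSpace (𝓨 i)] {μ : ∀ i, Measure (𝓨 i)} [∀ i, SigmaFinite (μ i)]
  {Θ : Type*} [MeasurableSpace Θ] {f : Θ → ∀ i, 𝓨 i → ℝ≥0} {θ₀ : Θ} {Y : ∀ i, Ω → 𝓨 i}

lemma div_natCast_le_ofReal_iff {a : ℝ≥0∞} {n : ℕ} (hn : n ≠ 0) (x : ℝ) :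
    a / n ≤ ENNReal.ofReal x ↔ a ≤ ENNReal.ofReal (n * x) := by
  rw [ENNReal.div_le_iff (by simpa using hn) (by simp), mul_comm, ENNReal.ofReal_mul (by simp),
    ENNReal.ofReal_natCast]

/-- Explicit bound for a fixed sample size, with `T = n ε²` and a free slack `d` in the evidence
bound. The prior mass `e^{-CT}` and the likelihood `e^{-(1+d)T}` on half of the Kullback–Leibler
neighbourhood bound the evidence from below. -/
lemma measure_le_posteriorProb_le_exp (hf : IsDensityFamily μ f) (hY : ∀ i, Measurable (Y i))
    (hindep : iIndepFun Y P)
    (hlaw : ∀ i, P.map (Y i) = (μ i).withDensity fun y => (f θ₀ i y : ℝ≥0∞))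
    (prior : Measure Θ) [IsProbabilityMeasure prior] {n : ℕ} (hn : n ≠ 0)
    {C R r c d M ε : ℝ} (hC : 0 < C) (hd : 0 < d) (hd1 : d ≤ 1)
    (hM : 8 * (|R| + |C| + 3) ≤ M) (hε : 0 < ε) (sieve : Set Θ)
    (hthick : ENNReal.ofReal (Real.exp (-(C * (n * ε ^ 2)))) ≤
      prior {θ | meanKL μ f n θ₀ θ ≤ ENNReal.ofReal (ε ^ 2) ∧
        meanKLSecondMoment μ f n θ₀ θ ≤ ENNReal.ofReal (ε ^ 2)})
    (hmass : prior sieveᶜ ≤ ENNReal.ofReal (c * Real.exp (-(r * (n * ε ^ 2)))))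
    (hentropy : ENNReal.log (ballCoveringNumber (maxHellinger μ f n) ε sieve : ℝ≥0∞) ≤
      ((R * (n * ε ^ 2) : ℝ) : EReal))
    {η : ℝ≥0∞} (hη : η ≠ 0) (hη' : η ≠ ∞) :
    P {ω | η ≤ edist (posteriorProb f prior θ₀ n (fun i => Y i ω)
        {θ | M * ε ≤ meanHellinger μ f n θ₀ θ}) 0}
      ≤ ENNReal.ofReal (1 / (d ^ 2 * (n * ε ^ 2))) * 2
        + (ENNReal.ofReal (4 * c * Real.exp (-((r - 1 - d - C) * (n * ε ^ 2))))
          + ENNReal.ofReal (2 * Real.exp (-(n * ε ^ 2)))) / η := by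
  set T : ℝ := n * ε ^ 2
  have hT : 0 < T := by positivity
  have hM0 : 1 ≤ M := by linarith [abs_nonneg R, abs_nonneg C]
  obtain ⟨S, hS, hcard⟩ := exists_finset_of_log_ballCoveringNumber_le hentropy
  have hden : 0 < Real.exp (-((1 + d + C) * T)) / 4 := by positivity
  -- The factor `1 / 4` instead of `1 / 2` makes the square root of the evidence bound explicit.
  have hroot : ENNReal.ofReal (Real.exp (-((1 + d + C) * T)) / 4) ^ (1 / 2 : ℝ)
      = ENNReal.ofReal (Real.exp (-((1 + d + C) * T / 2)) / 2) := by
    rw [ENNReal.ofReal_rpow_of_pos hden, ← Real.sqrt_eq_rpow]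
    congr 1
    rw [Real.sqrt_eq_iff_mul_self_eq hden.le (by positivity), div_mul_div_comm, ← Real.exp_add]
    congr 2
    · ring
    · norm_num
  refine (measure_le_posteriorProb_le hf hY hindep hlaw prior hn (by linarith) hε.le sieve S hS
    (ENNReal.ofReal (Real.exp (-((1 + d + C) * T)) / 4)) hη hη').trans ?_
  gcongr
  · refine le_trans (measure_mono fun ω hω => ?_)
      (measure_evidence_lt_le hf hY hindep hlaw prior n hT hd rfl)
    rw [Set.mem_ofPred_eq] at hω ⊢
    refine hω.trans_le ?_
    simp only [meanKL, meanKLSecondMoment, div_natCast_le_ofReal_iff hn] at hthick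
    calc ENNReal.ofReal (Real.exp (-((1 + d + C) * T)) / 4)
        ≤ ENNReal.ofReal (Real.exp (-((1 + d) * T)) * (Real.exp (-(C * T)) / 2)) := by
          refine ENNReal.ofReal_le_ofReal ?_
          rw [← mul_div_assoc, ← Real.exp_add,
            show -((1 + d) * T) + -(C * T) = -((1 + d + C) * T) by ring]
          linarith [Real.exp_pos (-((1 + d + C) * T))]
      _ = ENNReal.ofReal (Real.exp (-((1 + d) * T)))
          * (ENNReal.ofReal (Real.exp (-(C * T))) / 2) := by
          rw [ENNReal.ofReal_mul (Real.exp_pos _).le, ENNReal.ofReal_div_of_pos (by norm_num),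
            ENNReal.ofReal_ofNat]
      _ ≤ _ := by gcongr
  · refine (ENNReal.div_le_div_right hmass _).trans ?_
    rw [← ENNReal.ofReal_div_of_pos hden]
    refine ENNReal.ofReal_le_ofReal (le_of_eq ?_)
    rw [show -((r - 1 - d - C) * T) = -(r * T) - -((1 + d + C) * T) by ring, Real.exp_sub]
    field_simp
  · rw [hroot]
    calc _ ≤ ENNReal.ofReal (Real.exp (R * T)) * ENNReal.ofReal (Real.exp ((3 / 4 - M ^ 2 / 8) * T))
          / ENNReal.ofReal (Real.exp (-((1 + d + C) * T / 2)) / 2) := by gcongr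
      _ = ENNReal.ofReal (2 * Real.exp ((R + 3 / 4 - M ^ 2 / 8 + (1 + d + C) / 2) * T)) := by
        rw [← ENNReal.ofReal_mul (Real.exp_pos _).le, ← ENNReal.ofReal_div_of_pos (by positivity),
          ← Real.exp_add]
        congr 1
        rw [show (R + 3 / 4 - M ^ 2 / 8 + (1 + d + C) / 2) * T
          = (R * T + (3 / 4 - M ^ 2 / 8) * T) - -((1 + d + C) * T / 2) by ring, Real.exp_sub]
        field_simp
      _ ≤ _ := by
        gcongr
        have h1 : M ≤ M ^ 2 := by nlinarith
        have h2 : R + 3 / 4 - M ^ 2 / 8 + (1 + d + C) / 2 ≤ -1 := by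
          linarith [le_abs_self R, le_abs_self C, abs_nonneg C]
        nlinarith

/-- Posterior contraction for everywhere measurable observations. -/
lemma tendstoInMeasure_posteriorProb (hf : IsDensityFamily μ f) (hY : ∀ i, Measurable (Y i))
    (hindep : iIndepFun Y P)
    (hlaw : ∀ i, P.map (Y i) = (μ i).withDensity fun y => (f θ₀ i y : ℝ≥0∞))
    (prior : Measure Θ) [IsProbabilityMeasure prior] {C R r M : ℝ} {ε : ℕ → ℝ}
    (hthick : IsThick μ f prior θ₀ ε C) (sieve : ℕ → Set Θ) (hr : C + 1 < r)
    (hmass : ∃ c : ℝ, ∀ᶠ n : ℕ in atTop,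
      prior (sieve n)ᶜ ≤ ENNReal.ofReal (c * Real.exp (-(r * (n * ε n ^ 2)))))
    (hentropy : ∀ᶠ n : ℕ in atTop,
      ENNReal.log (ballCoveringNumber (maxHellinger μ f n) (ε n) (sieve n) : ℝ≥0∞) ≤
        ((R * (n * ε n ^ 2) : ℝ) : EReal))
    (hM : 8 * (|R| + |C| + 3) ≤ M) :
    TendstoInMeasure P (fun (n : ℕ) (ω : Ω) => posteriorProb f prior θ₀ n (fun i => Y i ω)
      {θ | M * ε n ≤ meanHellinger μ f n θ₀ θ}) atTop (fun _ => 0) := by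
  obtain ⟨c, hmass⟩ := hmass
  -- The slack in the evidence bound is at most `1` so that `M` need not depend on `r`.
  set d : ℝ := min 1 ((r - C - 1) / 2)
  have hd : 0 < d := lt_min one_pos (by linarith)
  have hdr : 0 < r - 1 - d - C := by
    have : d ≤ (r - C - 1) / 2 := min_le_right _ _
    linarith
  have hT := hthick.rate_sq_tendsto
  refine tendstoInMeasure_of_ne_top fun η hη hη' => ?_
  have hlim : Tendsto (fun n : ℕ => ENNReal.ofReal (1 / (d ^ 2 * (n * ε n ^ 2))) * 2
        + (ENNReal.ofReal (4 * c * Real.exp (-((r - 1 - d - C) * (n * ε n ^ 2))))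
          + ENNReal.ofReal (2 * Real.exp (-(n * ε n ^ 2)))) / η) atTop (𝓝 0) := by
    have h1 : Tendsto (fun n : ℕ => 1 / (d ^ 2 * (n * ε n ^ 2))) atTop (𝓝 0) := by
      simp only [one_div]
      exact tendsto_inv_atTop_zero.comp (hT.const_mul_atTop (by positivity))
    have h2 : Tendsto (fun n : ℕ => 4 * c * Real.exp (-((r - 1 - d - C) * (n * ε n ^ 2))))
        atTop (𝓝 0) := by
      simpa using (Real.tendsto_exp_neg_atTop_nhds_zero.comp
        (hT.const_mul_atTop hdr)).const_mul (4 * c)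
    have h3 : Tendsto (fun n : ℕ => 2 * Real.exp (-(n * ε n ^ 2))) atTop (𝓝 0) := by
      simpa using (Real.tendsto_exp_neg_atTop_nhds_zero.comp hT).const_mul 2
    have h1' := ENNReal.Tendsto.mul_const (b := 2) (ENNReal.tendsto_ofReal h1) (by simp)
    have h23 := ENNReal.Tendsto.div_const (b := η)
      ((ENNReal.tendsto_ofReal h2).add (ENNReal.tendsto_ofReal h3)) (Or.inr hη.ne')
    simpa using h1'.add h23
  refine tendsto_of_tendsto_of_tendsto_of_le_of_le' tendsto_const_nhds hlim
    (Eventually.of_forall fun _ => zero_le) ?_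
  filter_upwards [hthick.thick, hmass, hentropy, eventually_ne_atTop 0] with n h1 h2 h3 hn
  exact measure_le_posteriorProb_le_exp hf hY hindep hlaw prior hn hthick.const_pos hd
    (min_le_left _ _) hM (hthick.rate_pos n) (sieve n) h1 h2 h3 hη.ne' hη'

end Model

theorem theorem4 (C R : ℝ) :
    ∃ M₀ : ℝ, 0 < M₀ ∧
      ∀ {Ω : Type*} [MeasurableSpace Ω] (P : Measure Ω) [IsProbabilityMeasure P]
        {𝓨 : ℕ → Type*} [∀ i, MeasurableSpace (𝓨 i)]
        (μ : ∀ i, Measure (𝓨 i)) [∀ i, SigmaFinite (μ i)]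
        {Θ : Type*} [MeasurableSpace Θ] (prior : Measure Θ) [IsProbabilityMeasure prior]
        (f : Θ → ∀ i, 𝓨 i → ℝ≥0) (_hf : IsDensityFamily μ f) (θ₀ : Θ)
        (Y : ∀ i, Ω → 𝓨 i) (_hindep : iIndepFun Y P)
        (_hlaw : ∀ i, HasLaw (Y i) ((μ i).withDensity fun y => (f θ₀ i y : ℝ≥0∞)) P)
        (ε : ℕ → ℝ) (_hthick : IsThick μ f prior θ₀ ε C)
        (sieve : ℕ → Set Θ) (_hsieve : ∀ n, MeasurableSet (sieve n))
        (r : ℝ) (_hr : C + 1 < r)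
        (_hmass : ∃ c : ℝ, ∀ᶠ n : ℕ in atTop,
          prior (sieve n)ᶜ ≤ ENNReal.ofReal (c * Real.exp (-(r * (n * ε n ^ 2)))))
        (_hentropy : ∀ᶠ n : ℕ in atTop,
          ENNReal.log (ballCoveringNumber (maxHellinger μ f n) (ε n) (sieve n) : ℝ≥0∞) ≤
            ((R * (n * ε n ^ 2) : ℝ) : EReal)),
        ∀ M : ℝ, M₀ ≤ M →
          TendstoInMeasure P
            (fun (n : ℕ) (ω : Ω) => posteriorProb f prior θ₀ n (fun i => Y i ω)
              {θ | M * ε n ≤ meanHellinger μ f n θ₀ θ})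
            atTop (fun _ => 0) := by
  refine ⟨8 * (|R| + |C| + 3), by positivity, ?_⟩
  intro Ω _ P _ 𝓨 _ μ _ Θ _ prior _ f hf θ₀ Y hindep hlaw ε hthick sieve _ r hr hmass hentropy M hM
  -- Pass to measurable modifications of the observations.
  have hmod : ∀ i, Y i =ᵐ[P] (hlaw i).aemeasurable.mk (Y i) := fun i =>
    (hlaw i).aemeasurable.ae_eq_mk
  refine TendstoInMeasure.congr_left (fun n => ?_) (tendstoInMeasure_posteriorProb hf
    (fun i => (hlaw i).aemeasurable.measurable_mk) (hindep.congr hmod)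
    (fun i => ((hlaw i).congr (hmod i).symm).map_eq) prior hthick sieve hr hmass hentropy hM)
  filter_upwards [ae_all_iff.2 hmod] with ω hω
  simp only [hω]
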